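/- Let $G$ be a finite simple graph. Write $\tau(G)$ for the maximum number of vertices in an induced forest (acyclic induced subgraph) of $G$ and $\phi(G)$ for the minimum cardinality of a decycling set of $G$ (a set of vertices whose deletion leaves an acyclic graph). The girth of $G$ is the length of its shortest cycle, and $\infty$ if $G$ is acyclic. For an integer $r\ge 3$ and $p_0\in(0,1)$, consider the initial value problem on $[0,\infty)$ $$ \begin{aligned} \hat w' &= -r\hat s, \qquad \hat b' = -\hat b-r\hat t+r\hat s, \qquad \hat q'=-\frac{(2r-2)\hat q\hat s}{\hat w},\\ \hat s' &= -\hat s+\frac{(r-1)\hat q\hat s}{\hat w}-\frac{(r-1)\hat s^2}{\hat w}-\frac{r(r-2)\hat s\hat t}{(r-1)\hat b},\\ \hat t' &= -2\hat t+\frac{2(r-1)\hat s^2}{\hat w}-\frac{2r(r-2)\hat t^2}{(r-1)\hat b}, \end{aligned} $$ with $\hat w(0)=(1-p_0)^{r+1}$, $\hat b(0)=rp_0(1-p_0)^r$, $\hat q(0)=(1-p_0)^{2r}$, $\hat s(0)=(r-1)p_0(1-p_0)^{2r-1}$, $\hat t(0)=(r-1)^2p_0^2(1-p_0)^{2r-2}$.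 Put $$ \xi(r,p_0)=p_0(1-p_0)^r+\int_0^\infty \hat b(x)\,dx+ \begin{cases}\lim_{x\to\infty}\hat w(x) & \text{if } \lim_{x\to\infty}\frac{(r-1)\hat q(x)}{\hat w(x)}<1,\\ 0&\text{otherwise,}\end{cases} $$ where $(\hat w,\hat b,\hat q,\hat s,\hat t)$ is a solution that is positive on $[0,\infty)$. **Theorem.** (1) For every integer $r\ge 3$ and every $p_0\in(0,1)$ the number $\xi(r,p_0)$ is well defined: there is a positive solution for which the integral and both limits converge, and any two such solutions give the same value. Moreover, for every $\delta>0$ there is an integer $g>0$ such that every $r$-regular graph $G$ on $n$ vertices with girth at least $g$ satisfies $\tau(G)\ge(\xi(r,p_0)-\delta)n$. (2) For each row $(r,\xi,\Xi)$ of the table $$ \begin{array}{c|cccccccc} r&3&4&5&6&7&8&9&10\\ \hline \xi&0.7268&0.6045&0.5269&0.4711&0.4283&0.3940&0.3658&0.3419\\ \Xi&0.2732&0.3955&0.4731&0.5289&0.5717&0.6060&0.6342&0.6581 \end{array} $$ we have $\Xi=1-\xi$, and there is $p_0\in(0,1)$ for which $\xi$ is the truncation of $\xi(r,p_0)$ to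 four decimal places, that is, $\xi\le\xi(r,p_0)<\xi+10^{-4}$. Consequently, for every $\delta>0$ there is an integer $g>0$ such that every $r$-regular graph $G$ on $n$ vertices with girth at least $g$ satisfies $\tau(G)\ge(\xi-\delta)n$ and $\phi(G)\le(\Xi+\delta)n$. -/

import Mathlib

open Filter Topology MeasureTheory Set

/-- `τ(G)`: the maximum number of vertices in an induced forest of `G`. -/
noncomputable def inducedForestNumber {V : Type*} [Fintype V] (G : SimpleGraph V) : ℕ :=
  sSup {k : ℕ | ∃ S : Finset V, S.card = k ∧ (G.induce (S : Set V)).IsAcyclic}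

/-- `φ(G)`: the minimum cardinality of a decycling set of `G`, that is, of a set of vertices
whose deletion leaves an acyclic graph. -/
noncomputable def decyclingNumber {V : Type*} [Fintype V] (G : SimpleGraph V) : ℕ :=
  sInf {k : ℕ | ∃ S : Finset V, S.card = k ∧ (G.induce ((S : Set V)ᶜ)).IsAcyclic}

/-- `(w, b, q, s, t)` solves on `[0, ∞)` the system of differential equations associated with
`(r, p₀)`, including its initial conditions (the derivative at `0` is one-sided). -/
structure IsForestODESolution (r : ℕ) (p₀ : ℝ) (w b q s t : ℝ → ℝ) : Prop where
  deriv_w : ∀ x, 0 ≤ x → HasDerivWithinAt w (-(r * s x)) (Ici 0) x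
  deriv_b : ∀ x, 0 ≤ x → HasDerivWithinAt b (-b x - r * t x + r * s x) (Ici 0) x
  deriv_q : ∀ x, 0 ≤ x →
    HasDerivWithinAt q (-((2 * (r : ℝ) - 2) * q x * s x / w x)) (Ici 0) x
  deriv_s : ∀ x, 0 ≤ x →
    HasDerivWithinAt s
      (-s x + ((r : ℝ) - 1) * q x * s x / w x - ((r : ℝ) - 1) * s x ^ 2 / w x
        - (r : ℝ) * ((r : ℝ) - 2) * s x * t x / (((r : ℝ) - 1) * b x)) (Ici 0) x
  deriv_t : ∀ x, 0 ≤ x →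
    HasDerivWithinAt t
      (-2 * t x + 2 * ((r : ℝ) - 1) * s x ^ 2 / w x
        - 2 * (r : ℝ) * ((r : ℝ) - 2) * t x ^ 2 / (((r : ℝ) - 1) * b x)) (Ici 0) x
  init_w : w 0 = (1 - p₀) ^ (r + 1)
  init_b : b 0 = r * p₀ * (1 - p₀) ^ r
  init_q : q 0 = (1 - p₀) ^ (2 * r)
  init_s : s 0 = ((r : ℝ) - 1) * p₀ * (1 - p₀) ^ (2 * r - 1)
  init_t : t 0 = ((r : ℝ) - 1) ^ 2 * p₀ ^ 2 * (1 - p₀) ^ (2 * r - 2)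

open Classical in
/-- `c` is the constant `ξ(r, p₀)` obtained from the system associated with `(r, p₀)`: with
`wInf = lim w` and `ℓ = lim (r - 1) q / w`, it is `p₀ (1 - p₀) ^ r + ∫₀^∞ b`, plus `wInf` if
`ℓ < 1`. The solution, the convergence of the integral and both limits are part of the
assertion. -/
def IsForestConstant (r : ℕ) (p₀ c : ℝ) : Prop :=
  ∃ w b q s t : ℝ → ℝ, IsForestODESolution r p₀ w b q s t ∧
    (∀ x, 0 ≤ x → 0 < w x ∧ 0 < b x ∧ 0 < q x ∧ 0 < s x ∧ 0 < t x) ∧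
    IntegrableOn b (Ioi 0) ∧
    ∃ wInf ℓ : ℝ, Tendsto w atTop (𝓝 wInf) ∧
      Tendsto (fun x => ((r : ℝ) - 1) * q x / w x) atTop (𝓝 ℓ) ∧
      c = p₀ * (1 - p₀) ^ r + (∫ x in Ioi 0, b x) + if ℓ < 1 then wInf else 0

/-- The rows `(r, ξ(r), Ξ(r))` of the table of numerical values. -/
noncomputable def forestTable : List (ℕ × ℝ × ℝ) :=
  [(3, 0.7268, 0.2732), (4, 0.6045, 0.3955), (5, 0.5269, 0.4731), (6, 0.4711, 0.5289),
   (7, 0.4283, 0.5717), (8, 0.3940, 0.6060), (9, 0.3658, 0.6342), (10, 0.3419, 0.6581)]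

/-
Vertices receive independent random marks, with probability `p` in round `0` and `ε` in each later
round. A vertex marked in round `0` joins, and so does one that is marked at a time when exactly one
neighbour has joined. A vertex born last on a cycle would have two neighbours that joined before, so
the vertices none of whose neighbours is born in the same round induce a forest. Untouched vertices
can be added unless a long white walk starts there: for large girth, a cycle among them would itself
contain such a walk.

If the girth is large, the branches at a vertex are independent, and their probabilities follow the
recursion `branchLaw`. As `ε → 0` it approaches a flow with the first integral `potential`: the
survival probability of a branch tends to the zero `z` of `potential` below `1 - p`. The white walks
die out because `z` makes their branching process subcritical, and the expected share of the forest
tends to `forestValue r p z`.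

In the differential system, `w = (1 - p) v ^ r`, `q = (1 - p) ^ 2 v ^ (2 r - 2)` and `t = s ^ 2 / q`
for a solution `v` of the scalar equation `v' = -rate v`, because each defect satisfies a
homogeneous linear equation with zero initial value. So every positive solution yields the same
number `forestValue r p z`.
-/

open ProbabilityTheory unitInterval
open scoped Finset

section Independence

variable {Ω ι κ : Type*} [MeasurableSpace Ω] {μ : Measure Ω}

lemma measureReal_inter_of_iIndep {m : ι → MeasurableSpace Ω} (hm : ∀ i, m i ≤ ‹_›)
    (hμ : iIndep m μ) {S T : Set ι} (hST : Disjoint S T) {E F : Set Ω}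
    (hE : MeasurableSet[⨆ i ∈ S, m i] E) (hF : MeasurableSet[⨆ i ∈ T, m i] F) :
    μ.real (E ∩ F) = μ.real E * μ.real F := by
  have hindep : Indep (⨆ i ∈ S, m i) (⨆ i ∈ T, m i) μ := indep_iSup_of_disjoint hm hμ hST
  rw [measureReal_def, (Indep_iff _ _ μ).1 hindep E F hE hF, ENNReal.toReal_mul]
  rfl

lemma measureReal_biInter_of_iIndep {m : ι → MeasurableSpace Ω} (hm : ∀ i, m i ≤ ‹_›)
    (hμ : iIndep m μ) {s : Finset κ} {S : κ → Set ι} (hS : (s : Set κ).PairwiseDisjoint S)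
    {F : κ → Set Ω} (hF : ∀ k ∈ s, MeasurableSet[⨆ i ∈ S k, m i] (F k)) :
    μ.real (⋂ k ∈ s, F k) = ∏ k ∈ s, μ.real (F k) := by
  classical
  have := hμ.isProbabilityMeasure
  induction s using Finset.induction_on with
  | empty => simp
  | insert a s ha ih =>
    rw [Finset.coe_insert] at hS
    simp only [Finset.forall_mem_insert] at hF
    have hmeas : MeasurableSet[⨆ i ∈ ⋃ k ∈ s, S k, m i] (⋂ k ∈ s, F k) :=
      s.measurableSet_biInter fun k hk =>
        (biSup_mono fun _ hi => mem_biUnion hk hi : (⨆ i ∈ S k, m i) ≤ _) _ (hF.2 k hk)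
    have hdisj : Disjoint (S a) (⋃ k ∈ s, S k) := disjoint_iUnion₂_right.2 fun k hk =>
      hS (mem_insert a _) (mem_insert_of_mem a hk) fun h => ha (h ▸ hk)
    rw [Finset.set_biInter_insert, measureReal_inter_of_iIndep hm hμ hdisj hF.1 hmeas,
      Finset.prod_insert ha, ih (hS.subset (subset_insert a _)) hF.2]

lemma exists_sum_measureReal_le_card [Fintype κ] [IsProbabilityMeasure μ] {A : κ → Set Ω}
    (hA : ∀ k, MeasurableSet (A k)) :
    ∃ ω, ∑ k, μ.real (A k) ≤ {k | ω ∈ A k}.ncard := by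
  classical
  have hint : ∀ k, Integrable ((A k).indicator (1 : Ω → ℝ)) μ := fun k =>
    (integrable_const (1 : ℝ)).indicator (hA k)
  obtain ⟨ω, hω⟩ := exists_integral_le (integrable_finsetSum Finset.univ fun k _ => hint k)
  refine ⟨ω, ?_⟩
  rw [integral_finsetSum _ fun k _ => hint k] at hω
  have hreal : ∀ k, ∫ ω, (A k).indicator 1 ω ∂μ = μ.real (A k) := fun k =>
    integral_indicator_one (hA k)
  simp only [hreal] at hω
  simpa [indicator_apply, ncard_eq_toFinset_card'] using hω

end Independence

section ShortPaths

variable {V : Type*} {G : SimpleGraph V}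

lemma isPath_eq_of_length_add_lt_egirth {a b : V} {p q : G.Walk a b} (hp : p.IsPath)
    (hq : q.IsPath) (h : ((p.length + q.length : ℕ) : ℕ∞) < G.egirth) : p = q := by
  classical
  let H : SimpleGraph V := SimpleGraph.fromEdgeSet {e | e ∈ p.edges ++ q.edges}
  have mem_edgeSet : ∀ e ∈ p.edges ++ q.edges, e ∈ G.edgeSet := fun e he =>
    (List.mem_append.1 he).elim (p.edges_subset_edgeSet ·) (q.edges_subset_edgeSet ·)
  have mem_H : ∀ e ∈ p.edges ++ q.edges, e ∈ H.edgeSet := fun e he => by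
    rw [SimpleGraph.edgeSet_fromEdgeSet]
    exact ⟨he, G.not_isDiag_of_mem_edgeSet (mem_edgeSet e he)⟩
  have hHG : H ≤ G := fun x y hxy => mem_edgeSet s(x, y) ((SimpleGraph.fromEdgeSet_adj _).1 hxy).1
  have acyclic_H : H.IsAcyclic := by
    intro x c hc
    have subset : c.edges ⊆ p.edges ++ q.edges := fun e he => by
      have := c.edges_subset_edgeSet he
      rw [SimpleGraph.edgeSet_fromEdgeSet] at this
      exact this.1
    have length_le : c.length ≤ p.length + q.length := by
      simpa using (hc.edges_nodup.subperm subset).length_le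
    have egirth_le := SimpleGraph.egirth_le_length (hc.mapLe hHG)
    rw [SimpleGraph.Walk.length_map] at egirth_le
    exact absurd (egirth_le.trans (by exact_mod_cast length_le)) h.not_ge
  have hpH := fun e he => mem_H e (List.mem_append_left _ he)
  have hqH := fun e he => mem_H e (List.mem_append_right _ he)
  have transfer_eq : p.transfer H hpH = q.transfer H hqH :=
    congrArg Subtype.val ((acyclic_H.subsingleton_path a b).elim
      ⟨_, hp.transfer hpH⟩ ⟨_, hq.transfer hqH⟩)
  apply SimpleGraph.Walk.ext_support
  simpa only [SimpleGraph.Walk.support_transfer] using congrArg (·.support) transfer_eq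

/-- The ball of radius `j` around `u` in the branch that hangs from `w` through `u`: the vertices
reached from `u` by non-backtracking walks of at most `j` steps, the first of which does not lead
to `w`. -/
def branchBall (G : SimpleGraph V) : ℕ → V → V → Set V
  | 0, u, _ => {u}
  | j + 1, u, w => {u} ∪ ⋃ c ∈ {c | G.Adj u c ∧ c ≠ w}, branchBall G j c u

lemma self_mem_branchBall (j : ℕ) (u w : V) : u ∈ branchBall G j u w := by
  cases j <;> simp [branchBall]

lemma branchBall_subset_succ {j : ℕ} {u w c : V} (hc : G.Adj u c ∧ c ≠ w) :
    branchBall G j c u ⊆ branchBall G (j + 1) u w :=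
  subset_union_of_subset_right (subset_biUnion_of_mem (u := fun c => branchBall G j c u) hc) _

lemma branchBall_mono {j k : ℕ} (hjk : j ≤ k) (u w : V) :
    branchBall G j u w ⊆ branchBall G k u w := by
  induction j generalizing k u w with
  | zero => exact singleton_subset_iff.2 (self_mem_branchBall k u w)
  | succ j ih =>
    obtain ⟨k, rfl⟩ := Nat.exists_eq_add_of_lt hjk
    exact union_subset_union_right _ (biUnion_mono Subset.rfl fun c _ => ih (by omega) c u)

lemma exists_isPath_of_mem_branchBall {j : ℕ} (hg : ((j + 2 : ℕ) : ℕ∞) < G.egirth) {u w x : V}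
    (h : G.Adj w u) (hx : x ∈ branchBall G j u w) :
    ∃ p : G.Walk u x, p.IsPath ∧ p.length ≤ j ∧ w ∉ p.support := by
  classical
  induction j generalizing u w with
  | zero =>
    obtain rfl : x = u := hx
    exact ⟨.nil, .nil, le_rfl, by simpa using h.ne⟩
  | succ j ih =>
    rcases hx with rfl | hx
    · exact ⟨.nil, .nil, Nat.zero_le _, by simpa using h.ne⟩
    obtain ⟨c, ⟨huc, hcw⟩, hx⟩ := mem_iUnion₂.1 hx
    obtain ⟨p, hp, hl, hu⟩ := ih (lt_of_le_of_lt (by exact_mod_cast (by omega)) hg) huc hx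
    refine ⟨.cons huc p, hp.cons hu, by simpa using hl, ?_⟩
    rw [SimpleGraph.Walk.support_cons, List.mem_cons, not_or]
    refine ⟨h.ne, fun hw => hcw ?_⟩
    have hq : (SimpleGraph.Walk.cons huc (p.takeUntil w hw)).IsPath :=
      (hp.takeUntil hw).cons fun h' => hu (p.support_takeUntil_subset_support hw h')
    have hlen := p.length_takeUntil_le_length hw
    have cons_eq := isPath_eq_of_length_add_lt_egirth hq (SimpleGraph.Walk.IsPath.of_adj h.symm) (by
      refine lt_of_le_of_lt ?_ hg
      simp only [SimpleGraph.Walk.length_cons, SimpleGraph.Walk.length_nil]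
      exact_mod_cast (by omega))
    simpa using congrArg SimpleGraph.Walk.snd cons_eq

lemma notMem_branchBall {j : ℕ} (hg : ((j + 2 : ℕ) : ℕ∞) < G.egirth) {u w : V}
    (h : G.Adj w u) : w ∉ branchBall G j u w := fun hx =>
  let ⟨p, _, _, hw⟩ := exists_isPath_of_mem_branchBall hg h hx
  hw p.end_mem_support

lemma disjoint_branchBall {j : ℕ} (hg : ((2 * j + 2 : ℕ) : ℕ∞) < G.egirth) {u c c' : V}
    (h : G.Adj u c) (h' : G.Adj u c') (hne : c ≠ c') :
    Disjoint (branchBall G j c u) (branchBall G j c' u) := by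
  have hg' : ((j + 2 : ℕ) : ℕ∞) < G.egirth := lt_of_le_of_lt (by exact_mod_cast (by omega)) hg
  refine disjoint_left.2 fun x hx hx' => hne ?_
  obtain ⟨p, hp, hl, hu⟩ := exists_isPath_of_mem_branchBall hg' h hx
  obtain ⟨p', hp', hl', hu'⟩ := exists_isPath_of_mem_branchBall hg' h' hx'
  have cons_eq := isPath_eq_of_length_add_lt_egirth (hp.cons (h := h) hu) (hp'.cons (h := h') hu')
    (by
      refine lt_of_le_of_lt ?_ hg
      simp only [SimpleGraph.Walk.length_cons]
      exact_mod_cast (by omega))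
  simpa using congrArg SimpleGraph.Walk.snd cons_eq

end ShortPaths

section Growth

variable {V : Type*}

/-- The vertex has joined the growth process driven by the marks `X` by round `j`: the seeds are
the vertices marked in round `0`, and a vertex marked in round `j + 1` joins in that round if
exactly one of its neighbours has joined before. -/
def HasJoined (G : SimpleGraph V) (X : ℕ → V → Prop) : ℕ → V → Prop
  | 0, u => X 0 u
  | j + 1, u => HasJoined G X j u ∨ (X (j + 1) u ∧ ∃! c, G.Adj u c ∧ HasJoined G X j c)

/-- The vertex `u` has joined by round `j` in the version of the growth process that runs along
the non-backtracking walks that start at `u` and do not step to `w` first. -/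
def HasJoinedVia (G : SimpleGraph V) (X : ℕ → V → Prop) : ℕ → V → V → Prop
  | 0, u, _ => X 0 u
  | j + 1, u, w =>
    HasJoinedVia G X j u w ∨ (X (j + 1) u ∧ ∃! c, (G.Adj u c ∧ c ≠ w) ∧ HasJoinedVia G X j c u)

/-- In the growth process at `u` that avoids `w`, a mark in round `j + 1` makes `u` join. -/
def IsReady (G : SimpleGraph V) (X : ℕ → V → Prop) (j : ℕ) (u w : V) : Prop :=
  ¬ HasJoinedVia G X j u w ∧ ∃! c, (G.Adj u c ∧ c ≠ w) ∧ HasJoinedVia G X j c u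

/-- The neighbour `c` has joined by round `j` in its branch at `u`, and `u` has not been marked
since. -/
def IsTriggered (G : SimpleGraph V) (X : ℕ → V → Prop) (j : ℕ) (c u : V) : Prop :=
  HasJoinedVia G X j c u ∧ ∀ i < j, HasJoinedVia G X i c u → ¬ X (i + 1) u

/-- Neither the vertex nor any of its neighbours has joined by round `N`. -/
def IsUntouched (G : SimpleGraph V) (X : ℕ → V → Prop) (N : ℕ) (v : V) : Prop :=
  ¬ HasJoined G X N v ∧ ∀ c, G.Adj v c → ¬ HasJoined G X N c

/-- There is a walk of `K` steps from `u`, not stepping to `w` first, along which no seed occurs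
and no branch off the walk has joined by round `N`. -/
def HasWhiteWalk (G : SimpleGraph V) (X : ℕ → V → Prop) (N : ℕ) : ℕ → V → V → Prop
  | 0, _, _ => True
  | K + 1, u, w => ∃ c, (G.Adj u c ∧ c ≠ w) ∧ ¬ X 0 u ∧ HasWhiteWalk G X N K c u ∧
      ∀ c', (G.Adj u c' ∧ c' ≠ w) → c' ≠ c → ¬ HasJoinedVia G X N c' u

variable {G : SimpleGraph V} {X : ℕ → V → Prop}

lemma hasJoined_mono {i j : ℕ} (hij : i ≤ j) {u : V} (h : HasJoined G X i u) :
    HasJoined G X j u := by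
  induction hij with
  | refl => exact h
  | step _ ih => exact Or.inl ih

lemma hasJoinedVia_mono {i j : ℕ} (hij : i ≤ j) {u w : V} (h : HasJoinedVia G X i u w) :
    HasJoinedVia G X j u w := by
  induction hij with
  | refl => exact h
  | step _ ih => exact Or.inl ih

lemma hasJoinedVia_succ_and_not_iff {j : ℕ} {u w : V} :
    HasJoinedVia G X (j + 1) u w ∧ ¬ HasJoinedVia G X j u w ↔ X (j + 1) u ∧ IsReady G X j u w := by
  simp only [HasJoinedVia, IsReady]
  tauto

lemma isTriggered_succ_iff {j : ℕ} {c u : V} :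
    IsTriggered G X (j + 1) c u ↔
      (HasJoinedVia G X (j + 1) c u ∧ ¬ HasJoinedVia G X j c u) ∨
        (IsTriggered G X j c u ∧ ¬ X (j + 1) u) := by
  constructor
  · rintro ⟨hjoin, hmark⟩
    by_cases h : HasJoinedVia G X j c u
    · exact Or.inr ⟨⟨h, fun i hi => hmark i (by omega)⟩, hmark j (by omega) h⟩
    · exact Or.inl ⟨hjoin, h⟩
  · rintro (⟨hjoin, hnot⟩ | ⟨⟨hjoin, hmark⟩, hlast⟩)
    · exact ⟨hjoin, fun i hi h => absurd (hasJoinedVia_mono (Nat.lt_succ_iff.1 hi) h) hnot⟩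
    · refine ⟨hasJoinedVia_mono (Nat.le_succ j) hjoin, fun i hi h => ?_⟩
      rcases Nat.lt_succ_iff_lt_or_eq.1 hi with hi | rfl
      · exact hmark i hi h
      · exact hlast

lemma not_hasJoinedVia_of_forall_lt {j : ℕ} {u w : V} (h0 : ¬ X 0 u)
    (h : ∀ i < j, X (i + 1) u → ∀ c, G.Adj u c ∧ c ≠ w → ¬ HasJoinedVia G X i c u) :
    ¬ HasJoinedVia G X j u w := by
  induction j with
  | zero => exact h0
  | succ j ih =>
    rintro (hj | ⟨hX, c, ⟨hc, hjoin⟩, -⟩)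
    · exact ih (fun i hi => h i (by omega)) hj
    · exact h j (Nat.lt_succ_self j) hX c hc hjoin

lemma isReady_iff {j : ℕ} {u w : V} :
    IsReady G X j u w ↔ ∃ c, (G.Adj u c ∧ c ≠ w) ∧ ¬ X 0 u ∧ IsTriggered G X j c u ∧
      ∀ c', (G.Adj u c' ∧ c' ≠ w) → c' ≠ c → ¬ HasJoinedVia G X j c' u := by
  constructor
  · rintro ⟨hn, c, ⟨hc, hg⟩, huniq⟩
    refine ⟨c, hc, fun h => hn (hasJoinedVia_mono (Nat.zero_le j) h),
      ⟨hg, fun i hi hic hX => ?_⟩, fun c' hc' hne h => hne (huniq c' ⟨hc', h⟩)⟩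
    exact hn (hasJoinedVia_mono (Nat.succ_le_of_lt hi) (Or.inr ⟨hX, c, ⟨hc, hic⟩,
      fun c' h => huniq c' ⟨h.1, hasJoinedVia_mono hi.le h.2⟩⟩))
  · rintro ⟨c, hc, h0, ⟨hg, hX⟩, hne⟩
    refine ⟨not_hasJoinedVia_of_forall_lt h0 fun i hi hXi c' hc' hjoin => ?_, c, ⟨hc, hg⟩,
      fun c' h => by_contra fun h' => hne c' h.1 h' h.2⟩
    obtain rfl : c' = c := by_contra fun h => hne c' hc' h (hasJoinedVia_mono hi.le hjoin)
    exact hX i hi hjoin hXi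

lemma hasJoined_iff_hasJoinedVia {j : ℕ} {u w : V} (h : G.Adj u w) (hw : ¬ HasJoined G X j w) :
    HasJoined G X j u ↔ HasJoinedVia G X j u w := by
  induction j generalizing u w with
  | zero => rfl
  | succ j ih =>
    have hw' : ¬ HasJoined G X j w := fun h' => hw (hasJoined_mono (Nat.le_succ j) h')
    simp only [HasJoined, HasJoinedVia]
    rw [← ih h hw']
    refine or_congr_right' fun hu => and_congr_right fun _ => existsUnique_congr fun c => ⟨?_, ?_⟩
    · rintro ⟨hc, hg⟩
      exact ⟨⟨hc, fun h' => hw' (h' ▸ hg)⟩, (ih hc.symm hu).1 hg⟩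
    · rintro ⟨⟨hc, -⟩, hg⟩
      exact ⟨hc, (ih hc.symm hu).2 hg⟩

lemma hasJoined_iff_hasJoinedVia_self {j : ℕ} {v : V} :
    HasJoined G X j v ↔ HasJoinedVia G X j v v := by
  induction j with
  | zero => rfl
  | succ j ih =>
    simp only [HasJoined, HasJoinedVia, ← ih]
    refine or_congr_right' fun hv => and_congr_right fun _ => existsUnique_congr fun c => ?_
    exact ⟨fun h => ⟨⟨h.1, h.1.ne'⟩, (hasJoined_iff_hasJoinedVia h.1.symm hv).1 h.2⟩,
      fun h => ⟨h.1.1, (hasJoined_iff_hasJoinedVia h.1.1.symm hv).2 h.2⟩⟩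

lemma isUntouched_iff {N : ℕ} {v : V} :
    IsUntouched G X N v ↔ ¬ X 0 v ∧ ∀ c, G.Adj v c → ¬ HasJoinedVia G X N c v := by
  constructor
  · rintro ⟨h, hc⟩
    exact ⟨fun h' => h (hasJoined_mono (Nat.zero_le N) h'), fun c hvc h' =>
      hc c hvc ((hasJoined_iff_hasJoinedVia hvc.symm h).2 h')⟩
  · rintro ⟨h, hc⟩
    have hv : ¬ HasJoined G X N v := by
      rw [hasJoined_iff_hasJoinedVia_self]
      exact not_hasJoinedVia_of_forall_lt h fun i hi _ c hc' hjoin =>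
        hc c hc'.1 (hasJoinedVia_mono hi.le hjoin)
    exact ⟨hv, fun c hvc h' => hc c hvc ((hasJoined_iff_hasJoinedVia hvc.symm hv).1 h')⟩

lemma hasWhiteWalk_of_isPath {N : ℕ} {u w z : V} (p : G.Walk u z) (hp : p.IsPath)
    (hw : w ∉ p.support.tail) (huntouched : ∀ x ∈ p.support, IsUntouched G X N x) :
    HasWhiteWalk G X N p.length u w := by
  induction p generalizing w with
  | nil => trivial
  | @cons u c z h p ih =>
    rw [SimpleGraph.Walk.cons_isPath_iff] at hp
    rw [SimpleGraph.Walk.support_cons, List.tail_cons] at hw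
    have hu := isUntouched_iff.1 (huntouched u (by simp))
    refine ⟨c, ⟨h, fun h' => hw (h' ▸ p.start_mem_support)⟩, hu.1, ?_,
      fun c' hc' _ => hu.2 c' hc'.1⟩
    exact ih hp.1 (fun h' => hp.2 (List.mem_of_mem_tail h')) fun x hx => huntouched x (by simp [hx])

end Growth

section Forest

variable {V : Type*}

/-- The vertex joins the growth process in round `j`. -/
def IsBornAt (G : SimpleGraph V) (X : ℕ → V → Prop) (j : ℕ) (v : V) : Prop :=
  HasJoined G X j v ∧ ∀ i < j, ¬ HasJoined G X i v

/-- The vertex joins the growth process in round `j`, in which none of its neighbours joins. -/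
def IsIsolatedBirth (G : SimpleGraph V) (X : ℕ → V → Prop) (j : ℕ) (v : V) : Prop :=
  IsBornAt G X j v ∧ ∀ c, G.Adj v c → ¬ IsBornAt G X j c

/-- The vertices that join within `N` rounds, none of whose neighbours joins in the same round,
and the untouched vertices from which no white walk of `K` steps starts. -/
def forestSet (G : SimpleGraph V) (X : ℕ → V → Prop) (N K : ℕ) : Set V :=
  {v | (∃ j < N + 1, IsIsolatedBirth G X j v) ∨
    (IsUntouched G X N v ∧ ¬ HasWhiteWalk G X N K v v)}

variable {G : SimpleGraph V} {X : ℕ → V → Prop} {N K : ℕ}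

lemma isBornAt_zero_iff {v : V} : IsBornAt G X 0 v ↔ X 0 v := by
  simp [IsBornAt, HasJoined]

lemma isBornAt_succ_iff {j : ℕ} {v : V} :
    IsBornAt G X (j + 1) v ↔ X (j + 1) v ∧ IsReady G X j v v := by
  rw [← hasJoinedVia_succ_and_not_iff, ← hasJoined_iff_hasJoinedVia_self,
    ← hasJoined_iff_hasJoinedVia_self]
  exact and_congr_right fun _ => ⟨fun h => h j (Nat.lt_succ_self j),
    fun h i hi hi' => h (hasJoined_mono (Nat.lt_succ_iff.1 hi) hi')⟩

lemma IsBornAt.eq {i j : ℕ} {v : V} (hi : IsBornAt G X i v) (hj : IsBornAt G X j v) : i = j :=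
  le_antisymm (not_lt.1 fun h => hi.2 j h hj.1) (not_lt.1 fun h => hj.2 i h hi.1)

lemma IsBornAt.existsUnique {j : ℕ} {v : V} (h : IsBornAt G X (j + 1) v) :
    ∃! c, G.Adj v c ∧ HasJoined G X j c :=
  (h.1.resolve_left (h.2 j (Nat.lt_succ_self j))).2

lemma forall_mem_support_of_forall_adj {a b : V} (p : G.Walk a b) {P : V → Prop}
    (hP : ∀ x ∈ p.support, ∀ y ∈ p.support, G.Adj x y → P x → P y) (ha : P a) :
    ∀ x ∈ p.support, P x := by
  induction p with
  | nil => simpa using ha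
  | @cons a b c h p ih =>
    have hb : P b := hP a (by simp) b (by simp) h ha
    simp only [SimpleGraph.Walk.support_cons, List.forall_mem_cons] at hP ⊢
    exact ⟨ha, ih (fun x hx => (hP.2 x hx).2) hb⟩

/- A vertex of the cycle that is born last has two neighbours on the cycle, both of which had joined
before it. -/
lemma not_isCycle_of_forall_isIsolatedBirth {a : V} (c : G.Walk a a)
    (hborn : ∀ x ∈ c.support, ∃ j, IsIsolatedBirth G X j x) : ¬ c.IsCycle := by
  classical
  intro hc
  choose! birth hbirth using hborn
  obtain ⟨x, hx, hmax⟩ := Finset.exists_max_image c.support.toFinset birth ⟨a, by simp⟩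
  rw [List.mem_toFinset] at hx
  have hc' := hc.rotate hx
  have hlt : ∀ y ∈ (c.rotate x hx).support, G.Adj x y →
      birth y < birth x ∧ IsBornAt G X (birth y) y := by
    intro y hy hxy
    have hy' := (SimpleGraph.Walk.mem_support_rotate_iff c x hx).1 hy
    exact ⟨lt_of_le_of_ne (hmax y (by simpa using hy')) fun h =>
      (hbirth x hx).2 y hxy (h ▸ (hbirth y hy').1), (hbirth y hy').1⟩
  have adj_snd := (c.rotate x hx).adj_snd hc'.not_nil
  have adj_penultimate := ((c.rotate x hx).adj_penultimate hc'.not_nil).symm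
  obtain ⟨lt_snd, born_snd⟩ := hlt _ ((c.rotate x hx).getVert_mem_support 1) adj_snd
  obtain ⟨lt_penultimate, born_penultimate⟩ :=
    hlt _ ((c.rotate x hx).getVert_mem_support _) adj_penultimate
  obtain ⟨j, hj⟩ := Nat.exists_eq_add_one_of_ne_zero (Nat.ne_of_gt (Nat.zero_lt_of_lt lt_snd))
  have hborn_x := (hbirth x hx).1
  rw [hj] at hborn_x lt_snd lt_penultimate
  exact hc'.snd_ne_penultimate (hborn_x.existsUnique.unique
    ⟨adj_snd, hasJoined_mono (Nat.lt_succ_iff.1 lt_snd) born_snd.1⟩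
    ⟨adj_penultimate, hasJoined_mono (Nat.lt_succ_iff.1 lt_penultimate) born_penultimate.1⟩)

lemma not_isCycle_of_forall_isUntouched (hK : (K : ℕ∞) < G.egirth) {a : V} (c : G.Walk a a)
    (huntouched : ∀ x ∈ c.support, IsUntouched G X N x) (ha : ¬ HasWhiteWalk G X N K a a) :
    ¬ c.IsCycle := by
  intro hc
  have hlen : K < c.length := by exact_mod_cast hK.trans_le (SimpleGraph.egirth_le_length hc)
  have hp := hc.isPath_take hlen
  have hlen_take : (c.take K).length = K := by
    rw [SimpleGraph.Walk.take_length, min_eq_left hlen.le]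
  refine ha (hlen_take ▸ hasWhiteWalk_of_isPath (c.take K) hp ?_ fun x hx =>
    huntouched x ((c.isSubwalk_take K).support_subset hx))
  have := hp.support_nodup
  rw [← SimpleGraph.Walk.cons_tail_support] at this
  exact (List.nodup_cons.1 this).1

lemma not_isCycle_of_subset_forestSet (hK : (K : ℕ∞) < G.egirth) {a : V} (c : G.Walk a a)
    (hS : ∀ x ∈ c.support, x ∈ forestSet G X N K) : ¬ c.IsCycle := by
  have joined_of_born : ∀ x, (∃ j < N + 1, IsIsolatedBirth G X j x) → HasJoined G X N x :=
    fun x ⟨j, hj, hb⟩ => hasJoined_mono (Nat.lt_succ_iff.1 hj) hb.1.1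
  by_cases ha : HasJoined G X N a
  · have hall : ∀ x ∈ c.support, HasJoined G X N x :=
      forall_mem_support_of_forall_adj c (fun x _ y hy hxy hx => (hS y hy).elim
        (joined_of_born y) fun h => absurd hx (h.1.2 x hxy.symm)) ha
    refine not_isCycle_of_forall_isIsolatedBirth (X := X) c fun x hx => ?_
    obtain ⟨j, -, h⟩ := (hS x hx).resolve_right fun h => h.1.1 (hall x hx)
    exact ⟨j, h⟩
  · have hall : ∀ x ∈ c.support, ¬ HasJoined G X N x :=
      forall_mem_support_of_forall_adj c (fun x hx y _ hxy hx' => (hS x hx).elim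
        (fun h => absurd (joined_of_born x h) hx') fun h => h.1.2 y hxy) ha
    have huntouched : ∀ x ∈ c.support, IsUntouched G X N x ∧ ¬ HasWhiteWalk G X N K x x :=
      fun x hx => (hS x hx).resolve_left fun h => hall x hx (joined_of_born x h)
    exact not_isCycle_of_forall_isUntouched hK c (fun x hx => (huntouched x hx).1)
      (huntouched a c.start_mem_support).2

lemma isAcyclic_induce_forestSet (hK : (K : ℕ∞) < G.egirth) :
    (G.induce (forestSet G X N K)).IsAcyclic := by
  intro a c hc
  refine not_isCycle_of_subset_forestSet (X := X) (N := N) hK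
    (c.map (SimpleGraph.Embedding.induce _).toHom) (fun x hx => ?_)
    (hc.map (SimpleGraph.Embedding.induce (G := G) _).injective)
  rw [SimpleGraph.Walk.support_map, List.mem_map] at hx
  obtain ⟨y, -, rfl⟩ := hx
  exact y.2

lemma ncard_le_inducedForestNumber [Fintype V] {S : Set V} (h : (G.induce S).IsAcyclic) :
    S.ncard ≤ inducedForestNumber G := by
  classical
  refine le_csSup ⟨Fintype.card V, ?_⟩ ⟨S.toFinset, ?_, by rwa [coe_toFinset]⟩
  · rintro k ⟨T, rfl, -⟩
    exact Finset.card_le_univ T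
  · rw [ncard_eq_toFinset_card']

end Forest

section Measurability

variable {V Ω : Type*} {m : MeasurableSpace Ω} {G : SimpleGraph V}
  {X : Ω → ℕ → V → Prop}

lemma measurable_and_of_imp {a : Prop} {q : Ω → Prop} (h : a → Measurable q) :
    Measurable fun ω => a ∧ q ω := by
  by_cases ha : a
  · exact measurable_const.and (h ha)
  · simp only [ha, false_and]
    exact measurable_const

lemma measurable_imp_of_imp {a : Prop} {q : Ω → Prop} (h : a → Measurable q) :
    Measurable fun ω => a → q ω := by
  by_cases ha : a
  · simpa only [ha, true_imp_iff] using h ha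
  · simp only [ha, false_imp_iff]
    exact measurable_const

lemma measurable_existsUnique {κ : Type*} [Countable κ] {q : κ → Ω → Prop}
    (h : ∀ k, Measurable (q k)) : Measurable fun ω => ∃! k, q k ω :=
  .exists fun k => (h k).and <| .forall fun l => (h l).imp measurable_const

variable [Countable V]

lemma measurable_hasJoinedVia {j : ℕ} {u w : V}
    (h : ∀ i ≤ j, ∀ x ∈ branchBall G j u w, Measurable fun ω => X ω i x) :
    Measurable fun ω => HasJoinedVia G (X ω) j u w := by
  induction j generalizing u w with
  | zero => exact h 0 le_rfl u (self_mem_branchBall 0 u w)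
  | succ j ih =>
    have hcurrent : Measurable fun ω => HasJoinedVia G (X ω) j u w :=
      ih fun i hi x hx => h i (by omega) x (branchBall_mono (Nat.le_succ j) u w hx)
    have hbranch : ∀ c, G.Adj u c ∧ c ≠ w → Measurable fun ω => HasJoinedVia G (X ω) j c u :=
      fun c hc => ih fun i hi x hx => h i (by omega) x (branchBall_subset_succ hc hx)
    exact hcurrent.or ((h (j + 1) le_rfl u (self_mem_branchBall _ u w)).and
      (measurable_existsUnique fun c => measurable_and_of_imp (hbranch c)))

lemma measurable_isTriggered {j : ℕ} {c u : V}
    (h : ∀ i ≤ j, ∀ x ∈ branchBall G j c u, Measurable fun ω => X ω i x)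
    (hu : ∀ i < j, Measurable fun ω => X ω (i + 1) u) :
    Measurable fun ω => IsTriggered G (X ω) j c u := by
  refine (measurable_hasJoinedVia h).and (.forall fun i => measurable_imp_of_imp fun hi => ?_)
  exact (measurable_hasJoinedVia fun k hk x hx =>
    h k (by omega) x (branchBall_mono hi.le c u hx)).imp (hu i hi).not

lemma measurable_isReady {j : ℕ} (h : ∀ i ≤ j, ∀ x, Measurable fun ω => X ω i x) (u w : V) :
    Measurable fun ω => IsReady G (X ω) j u w :=
  (measurable_hasJoinedVia fun i hi x _ => h i hi x).not.and <| measurable_existsUnique fun _ =>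
    measurable_const.and (measurable_hasJoinedVia fun i hi x _ => h i hi x)

lemma measurable_hasWhiteWalk {N K : ℕ} {u w : V}
    (h : ∀ i, ∀ x ∈ branchBall G (N + K) u w, Measurable fun ω => X ω i x) :
    Measurable fun ω => HasWhiteWalk G (X ω) N K u w := by
  induction K generalizing u w with
  | zero => exact measurable_const
  | succ K ih =>
    refine .exists fun c => measurable_and_of_imp fun hc =>
      (h 0 u (self_mem_branchBall _ u w)).not.and <| .and ?_ <| .forall fun c' =>
        measurable_imp_of_imp fun hc' => measurable_const.imp <| .not ?_
    · exact ih fun i x hx => h i x (branchBall_subset_succ hc hx)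
    · exact measurable_hasJoinedVia fun i _ x hx =>
        h i x (branchBall_subset_succ hc' (branchBall_mono (Nat.le_add_right N K) c' u hx))

lemma measurable_hasJoined (h : ∀ i x, Measurable fun ω => X ω i x) (j : ℕ) (v : V) :
    Measurable fun ω => HasJoined G (X ω) j v := by
  simp only [hasJoined_iff_hasJoinedVia_self]
  exact measurable_hasJoinedVia fun i _ x _ => h i x

lemma measurable_isBornAt (h : ∀ i x, Measurable fun ω => X ω i x) (j : ℕ) (v : V) :
    Measurable fun ω => IsBornAt G (X ω) j v :=
  (measurable_hasJoined h j v).and <| .forall fun i =>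
    measurable_const.imp (measurable_hasJoined h i v).not

lemma measurable_isIsolatedBirth (h : ∀ i x, Measurable fun ω => X ω i x) (j : ℕ) (v : V) :
    Measurable fun ω => IsIsolatedBirth G (X ω) j v :=
  (measurable_isBornAt h j v).and <| .forall fun c =>
    measurable_const.imp (measurable_isBornAt h j c).not

lemma measurable_isUntouched (h : ∀ i x, Measurable fun ω => X ω i x) (N : ℕ) (v : V) :
    Measurable fun ω => IsUntouched G (X ω) N v :=
  (measurable_hasJoined h N v).not.and <| .forall fun c =>
    measurable_const.imp (measurable_hasJoined h N c).not

lemma measurable_mem_forestSet (h : ∀ i x, Measurable fun ω => X ω i x) (N K : ℕ) (v : V) :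
    Measurable fun ω => v ∈ forestSet G (X ω) N K :=
  (Measurable.exists fun j => measurable_const.and (measurable_isIsolatedBirth h j v)).or <|
    (measurable_isUntouched h N v).and (measurable_hasWhiteWalk fun i x _ => h i x).not

end Measurability

section Marking

variable {V Ω : Type*}

/-- The marks `X` are mutually independent; those of round `0` have probability `p` and those of
the later rounds have probability `ε`. -/
structure IsMarking [MeasurableSpace Ω] (X : Ω → ℕ → V → Prop) (p ε : ℝ) (P : Measure Ω) :
    Prop where
  measurable_mark : ∀ j v, Measurable fun ω => X ω j v
  indep_marks : iIndepFun (fun (i : ℕ × V) ω => X ω i.1 i.2) P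
  real_seed : ∀ v, P.real {ω | X ω 0 v} = p
  real_mark : ∀ j v, P.real {ω | X ω (j + 1) v} = ε

lemma exists_isMarking (V : Type*) (p ε : I) :
    ∃ P : Measure (ℕ × V → Prop), IsProbabilityMeasure P ∧
      IsMarking (fun ω j v => ω (j, v)) p ε P := by
  let bias : ℕ × V → I := fun i => if i.1 = 0 then p else ε
  let P := Measure.infinitePi fun i => Ber(True, False, bias i)
  have hreal : ∀ i, P.real {ω | ω i} = bias i := fun i => by
    have hmap : P.map (fun ω => ω i) = Ber(True, False, bias i) :=
      Measure.infinitePi_map_eval _ i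
    classical
    have := bernoulliMeasure_real_apply (x := True) (y := False) (bias i)
      (MeasurableSet.of_discrete (s := {a : Prop | a}))
    rw [← hmap, map_measureReal_apply (measurable_pi_apply i) .of_discrete] at this
    simpa using this
  refine ⟨P, inferInstance, fun j v => measurable_pi_apply (j, v), ?_, fun v => ?_, fun j v => ?_⟩
  · exact iIndepFun_infinitePi (X := fun _ a => a) fun _ => measurable_id
  · exact (hreal (0, v)).trans (by simp [bias])
  · exact (hreal (j + 1, v)).trans (by simp [bias])

/-- The σ-algebra generated by the marks `X ω i.1 i.2` with `i ∈ S`. -/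
abbrev marksAlgebra (X : Ω → ℕ → V → Prop) (S : Set (ℕ × V)) : MeasurableSpace Ω :=
  ⨆ i ∈ S, MeasurableSpace.comap (fun ω => X ω i.1 i.2) inferInstance

lemma measurable_marksAlgebra {X : Ω → ℕ → V → Prop} {S : Set (ℕ × V)} {j : ℕ} {v : V}
    (h : (j, v) ∈ S) : Measurable[marksAlgebra X S] fun ω => X ω j v :=
  (comap_measurable _).mono
    (le_biSup (fun i => MeasurableSpace.comap (fun ω => X ω i.1 i.2) inferInstance) h) le_rfl

end Marking

section BranchLaw

variable {V : Type*} {G : SimpleGraph V}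

open Classical in
/-- The neighbours of `u` other than `w`. -/
noncomputable def children (G : SimpleGraph V) [G.LocallyFinite] (u w : V) : Finset V :=
  (G.neighborFinset u).erase w

lemma mem_children [G.LocallyFinite] {u w c : V} : c ∈ children G u w ↔ G.Adj u c ∧ c ≠ w := by
  simp [children, and_comm]

lemma card_children_of_adj [G.LocallyFinite] {r : ℕ} (hr : G.IsRegularOfDegree r) {u w : V}
    (h : G.Adj u w) : #(children G u w) = r - 1 := by
  classical
  rw [children, Finset.card_erase_of_mem (by simpa using h),
    SimpleGraph.card_neighborFinset_eq_degree, hr u]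

lemma card_children_self [G.LocallyFinite] {r : ℕ} (hr : G.IsRegularOfDegree r) (u : V) :
    #(children G u u) = r := by
  classical
  rw [children, Finset.erase_eq_of_notMem (by simp), SimpleGraph.card_neighborFinset_eq_degree,
    hr u]

/-- The expected number of children of a vertex of an `r`-regular graph through which a white walk
continues, when the branches below it are unreached with probability `v`. -/
noncomputable def meanOffspring (r : ℕ) (p v : ℝ) : ℝ :=
  (1 - p) * ((r : ℝ) - 1) * v ^ (r - 2)

/-- The probabilities that a branch of an `r`-regular graph has not reached its root after `j`
rounds, and that it has reached its root, which has not been marked since. -/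
noncomputable def branchLaw (r : ℕ) (p ε : ℝ) : ℕ → ℝ × ℝ
  | 0 => (1 - p, p)
  | j + 1 =>
    let x := branchLaw r p ε j
    let y := x.2 * meanOffspring r p x.1
    (x.1 - ε * y, (1 - ε) * x.2 + ε * y)

variable {Ω : Type*} [MeasurableSpace Ω] {X : Ω → ℕ → V → Prop} {p ε : ℝ} {P : Measure Ω}

namespace IsMarking

variable (hX : IsMarking X p ε P)

include hX

lemma isProbabilityMeasure : IsProbabilityMeasure P :=
  hX.indep_marks.isProbabilityMeasure

lemma iIndep_marks : iIndep
    (fun i : ℕ × V => MeasurableSpace.comap (fun ω => X ω i.1 i.2) inferInstance) P :=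
  (iIndepFun_iff_iIndep ..).1 hX.indep_marks

lemma real_and {S T : Set (ℕ × V)} (hST : Disjoint S T) {a b : Ω → Prop}
    (ha : Measurable[marksAlgebra X S] a) (hb : Measurable[marksAlgebra X T] b) :
    P.real {ω | a ω ∧ b ω} = P.real {ω | a ω} * P.real {ω | b ω} :=
  measureReal_inter_of_iIndep
    (m := fun i : ℕ × V => MeasurableSpace.comap (fun ω => X ω i.1 i.2) inferInstance)
    (fun i => (hX.measurable_mark i.1 i.2).comap_le)
    hX.iIndep_marks hST
    (@Measurable.setOf _ (marksAlgebra X S) _ ha) (@Measurable.setOf _ (marksAlgebra X T) _ hb)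

lemma real_forall {κ : Type*} {s : Finset κ} {S : κ → Set (ℕ × V)}
    (hS : (s : Set κ).PairwiseDisjoint S) {a : κ → Ω → Prop}
    (ha : ∀ k ∈ s, Measurable[marksAlgebra X (S k)] (a k)) :
    P.real {ω | ∀ k ∈ s, a k ω} = ∏ k ∈ s, P.real {ω | a k ω} := by
  have hset : {ω | ∀ k ∈ s, a k ω} = ⋂ k ∈ s, {ω | a k ω} := by
    ext ω
    simp only [mem_ofPred_eq, mem_iInter]
  rw [hset]
  exact measureReal_biInter_of_iIndep
    (m := fun i : ℕ × V => MeasurableSpace.comap (fun ω => X ω i.1 i.2) inferInstance)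
    (fun i => (hX.measurable_mark i.1 i.2).comap_le) hX.iIndep_marks hS
    fun k hk => @Measurable.setOf _ (marksAlgebra X (S k)) _ (ha k hk)

lemma real_not_seed (v : V) : P.real {ω | ¬ X ω 0 v} = 1 - p := by
  have := hX.isProbabilityMeasure
  rw [← hX.real_seed v, ← probReal_compl_eq_one_sub (hX.measurable_mark 0 v).setOf]
  rfl

variable [Countable V]

/- The marks at `u` other than the one of round `0` are assigned to the branch of `c₀`. -/
lemma real_not_seed_and_forall {M : ℕ} (hg : ((2 * M + 2 : ℕ) : ℕ∞) < G.egirth) {u : V}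
    {s : Finset V} (hs : ∀ c ∈ s, G.Adj u c) (c₀ : V) {a : V → Ω → Prop}
    (ha : ∀ c ∈ s, Measurable[marksAlgebra X
      {i | i.2 ∈ branchBall G M c u ∨ (c = c₀ ∧ i.2 = u ∧ i.1 ≠ 0)}] (a c)) :
    P.real {ω | ¬ X ω 0 u ∧ ∀ c ∈ s, a c ω} = (1 - p) * ∏ c ∈ s, P.real {ω | a c ω} := by
  have hg' : ((M + 2 : ℕ) : ℕ∞) < G.egirth := lt_of_le_of_lt (by exact_mod_cast (by omega)) hg
  have hu : ∀ c ∈ s, u ∉ branchBall G M c u := fun c hc => notMem_branchBall hg' (hs c hc)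
  let S : V → Set (ℕ × V) := fun c =>
    {i | i.2 ∈ branchBall G M c u ∨ (c = c₀ ∧ i.2 = u ∧ i.1 ≠ 0)}
  have hpairwise : (s : Set V).PairwiseDisjoint S := by
    rintro c hc d hd hcd
    refine disjoint_left.2 ?_
    rintro ⟨j, x⟩ (hx | ⟨rfl, rfl, -⟩) (hx' | ⟨hd₀, hx', -⟩)
    · exact disjoint_left.1 (disjoint_branchBall hg (hs c hc) (hs d hd) hcd) hx hx'
    · exact hu c hc (hx' ▸ hx)
    · exact hu d hd hx'
    · exact hcd hd₀.symm
  have hroot : Disjoint {(0, u)} (⋃ c ∈ s, S c) := by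
    refine disjoint_iUnion₂_right.2 fun c hc => disjoint_singleton_left.2 ?_
    rintro (hx | ⟨-, -, h⟩)
    · exact hu c hc hx
    · exact h rfl
  have hmeas : Measurable[marksAlgebra X (⋃ c ∈ s, S c)] fun ω => ∀ c ∈ s, a c ω :=
    @Measurable.forall _ _ (marksAlgebra X (⋃ c ∈ s, S c)) _ _ fun c =>
      measurable_imp_of_imp fun hc =>
        (ha c hc).mono (biSup_mono fun _ hi => mem_biUnion hc hi) le_rfl
  rw [hX.real_and hroot
    (@Measurable.not _ (marksAlgebra X _) _ (measurable_marksAlgebra (mem_singleton _))) hmeas,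
    hX.real_not_seed, hX.real_forall hpairwise ha]

lemma real_sole_branch {N M : ℕ} (hNM : N ≤ M)
    (hg : ((2 * M + 2 : ℕ) : ℕ∞) < G.egirth) {v : ℝ}
    (hv : ∀ u c, G.Adj u c → P.real {ω | ¬ HasJoinedVia G (X ω) N c u} = v)
    {u c : V} {s : Finset V} (hs : ∀ c ∈ s, G.Adj u c) (hc : c ∈ s) {a : Ω → Prop}
    (ha : Measurable[marksAlgebra X {i | i.2 ∈ branchBall G M c u ∨ (i.2 = u ∧ i.1 ≠ 0)}] a) :
    P.real {ω | ¬ X ω 0 u ∧ a ω ∧ ∀ c' ∈ s, c' ≠ c → ¬ HasJoinedVia G (X ω) N c' u} =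
      (1 - p) * (P.real {ω | a ω} * v ^ (#s - 1)) := by
  classical
  let b : V → Ω → Prop := fun c' ω => if c' = c then a ω else ¬ HasJoinedVia G (X ω) N c' u
  have hset : {ω | ¬ X ω 0 u ∧ a ω ∧ ∀ c' ∈ s, c' ≠ c → ¬ HasJoinedVia G (X ω) N c' u} =
      {ω | ¬ X ω 0 u ∧ ∀ c' ∈ s, b c' ω} := by
    ext ω
    refine and_congr_right fun _ => ⟨fun h c' hc' => ?_, fun h => ⟨by simpa [b] using h c hc, ?_⟩⟩
    · simp only [b]
      split_ifs with hne
      · exact h.1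
      · exact h.2 c' hc' hne
    · exact fun c' hc' hne => by simpa [b, hne] using h c' hc'
  have hb : ∀ c' ∈ s, Measurable[marksAlgebra X
      {i | i.2 ∈ branchBall G M c' u ∨ (c' = c ∧ i.2 = u ∧ i.1 ≠ 0)}] (b c') := by
    intro c' _
    by_cases hne : c' = c
    · subst hne
      simp only [b, if_true]
      exact ha.mono (biSup_mono fun i hi => hi.imp_right fun h => ⟨rfl, h⟩) le_rfl
    · simp only [b, hne, if_false]
      exact @Measurable.not _ (marksAlgebra X _) _ (measurable_hasJoinedVia fun i _ x hx =>
        measurable_marksAlgebra (Or.inl (branchBall_mono hNM c' u hx)))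
  have hprod : ∏ c' ∈ s.erase c, P.real {ω | b c' ω} = v ^ (#s - 1) := by
    rw [← Finset.card_erase_of_mem hc, ← Finset.prod_const]
    refine Finset.prod_congr rfl fun c' hc' => ?_
    simp only [b, Finset.ne_of_mem_erase hc', if_false]
    exact hv u c' (hs c' (Finset.mem_of_mem_erase hc'))
  rw [hset, hX.real_not_seed_and_forall hg hs c hb, ← Finset.mul_prod_erase s _ hc, hprod]
  simp only [b, if_true]

lemma real_isReady [G.LocallyFinite] {j : ℕ} (hg : ((2 * j + 2 : ℕ) : ℕ∞) < G.egirth) {v a : ℝ}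
    (hv : ∀ u c, G.Adj u c → P.real {ω | ¬ HasJoinedVia G (X ω) j c u} = v)
    (ha : ∀ u c, G.Adj u c → P.real {ω | IsTriggered G (X ω) j c u} = a) (u w : V) :
    P.real {ω | IsReady G (X ω) j u w} =
      #(children G u w) * ((1 - p) * (a * v ^ (#(children G u w) - 1))) := by
  have := hX.isProbabilityMeasure
  have hs : ∀ c ∈ children G u w, G.Adj u c := fun c hc => (mem_children.1 hc).1
  have hmark := hX.measurable_mark
  let B : V → Set Ω := fun c => {ω | ¬ X ω 0 u ∧ IsTriggered G (X ω) j c u ∧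
    ∀ c' ∈ children G u w, c' ≠ c → ¬ HasJoinedVia G (X ω) j c' u}
  have hset : {ω | IsReady G (X ω) j u w} = ⋃ c ∈ children G u w, B c := by
    ext ω
    simp only [mem_ofPred_eq, isReady_iff, ← mem_children, mem_iUnion, exists_prop, B]
  have hdisj : (children G u w : Set V).PairwiseDisjoint B := fun c hc d _ hcd =>
    disjoint_left.2 fun ω h h' => h'.2.2 c hc hcd h.2.1.1
  have hmeas : ∀ c ∈ children G u w, MeasurableSet (B c) := fun c _ =>
    ((hmark 0 u).not.and <| (measurable_isTriggered (fun i _ x _ => hmark i x)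
      fun i _ => hmark (i + 1) u).and <| .forall fun c' => measurable_const.imp <|
        measurable_const.imp (measurable_hasJoinedVia fun i _ x _ => hmark i x).not).setOf
  rw [hset, measureReal_biUnion_finset hdisj hmeas, ← nsmul_eq_mul, ← Finset.sum_const]
  refine Finset.sum_congr rfl fun c hc => ?_
  rw [hX.real_sole_branch le_rfl hg hv hs hc, ha u c (hs c hc)]
  exact measurable_isTriggered (fun i _ x hx => measurable_marksAlgebra (Or.inl hx)) fun i _ =>
    measurable_marksAlgebra (Or.inr ⟨rfl, Nat.succ_ne_zero i⟩)

lemma real_mark_and_isReady (j : ℕ) (u w : V) :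
    P.real {ω | X ω (j + 1) u ∧ IsReady G (X ω) j u w} =
      ε * P.real {ω | IsReady G (X ω) j u w} := by
  rw [← hX.real_mark j u]
  exact hX.real_and (S := {(j + 1, u)}) (T := {i | i.1 ≤ j}) (by simp)
    (measurable_marksAlgebra (mem_singleton _))
    (measurable_isReady (fun i hi x => measurable_marksAlgebra hi) u w)

lemma real_isTriggered_and_not_mark (j : ℕ) (c u : V) :
    P.real {ω | IsTriggered G (X ω) j c u ∧ ¬ X ω (j + 1) u} =
      P.real {ω | IsTriggered G (X ω) j c u} * (1 - ε) := by
  have := hX.isProbabilityMeasure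
  rw [← hX.real_mark j u, ← probReal_compl_eq_one_sub (hX.measurable_mark (j + 1) u).setOf]
  exact hX.real_and (S := {i | i.1 ≤ j}) (T := {(j + 1, u)}) (by simp)
    (measurable_isTriggered (fun i hi x _ => measurable_marksAlgebra hi)
      fun i hi => measurable_marksAlgebra (Nat.succ_le_of_lt hi))
    (@Measurable.not _ (marksAlgebra X _) _ (measurable_marksAlgebra (mem_singleton _)))

lemma real_not_hasJoinedVia_succ (j : ℕ) (u w : V) :
    P.real {ω | ¬ HasJoinedVia G (X ω) (j + 1) u w} =
      P.real {ω | ¬ HasJoinedVia G (X ω) j u w} - ε * P.real {ω | IsReady G (X ω) j u w} := by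
  have := hX.isProbabilityMeasure
  have hset : {ω | ¬ HasJoinedVia G (X ω) (j + 1) u w} = {ω | ¬ HasJoinedVia G (X ω) j u w} \
      {ω | X ω (j + 1) u ∧ IsReady G (X ω) j u w} := by
    ext ω
    have : HasJoinedVia G (X ω) j u w → HasJoinedVia G (X ω) (j + 1) u w :=
      hasJoinedVia_mono (Nat.le_succ j)
    simp only [Set.mem_sdiff, mem_ofPred_eq, ← hasJoinedVia_succ_and_not_iff]
    tauto
  rw [hset, measureReal_sdiff (fun ω h => h.2.1), hX.real_mark_and_isReady]
  exact ((hX.measurable_mark (j + 1) u).and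
    (measurable_isReady (fun i _ x => hX.measurable_mark i x) u w)).setOf

lemma real_isTriggered_succ (j : ℕ) (c u : V) :
    P.real {ω | IsTriggered G (X ω) (j + 1) c u} =
      ε * P.real {ω | IsReady G (X ω) j c u} +
        P.real {ω | IsTriggered G (X ω) j c u} * (1 - ε) := by
  have := hX.isProbabilityMeasure
  have hset : {ω | IsTriggered G (X ω) (j + 1) c u} =
      {ω | X ω (j + 1) c ∧ IsReady G (X ω) j c u} ∪
        {ω | IsTriggered G (X ω) j c u ∧ ¬ X ω (j + 1) u} := by
    ext ω
    exact isTriggered_succ_iff.trans (or_congr_left hasJoinedVia_succ_and_not_iff)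
  have hdisj : Disjoint {ω | X ω (j + 1) c ∧ IsReady G (X ω) j c u}
      {ω | IsTriggered G (X ω) j c u ∧ ¬ X ω (j + 1) u} :=
    disjoint_left.2 fun ω h h' => h.2.1 h'.1.1
  rw [hset, measureReal_union hdisj, hX.real_mark_and_isReady, hX.real_isTriggered_and_not_mark]
  exact ((measurable_isTriggered (fun i _ x _ => hX.measurable_mark i x) fun i _ =>
    hX.measurable_mark (i + 1) u).and (hX.measurable_mark (j + 1) u).not).setOf

theorem real_branchLaw [G.LocallyFinite] {r : ℕ} (hr : G.IsRegularOfDegree r) {j : ℕ}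
    (hg : ((2 * j + 2 : ℕ) : ℕ∞) < G.egirth) :
    (∀ u c, G.Adj u c → P.real {ω | ¬ HasJoinedVia G (X ω) j c u} = (branchLaw r p ε j).1) ∧
      ∀ u c, G.Adj u c → P.real {ω | IsTriggered G (X ω) j c u} = (branchLaw r p ε j).2 := by
  induction j with
  | zero =>
    exact ⟨fun u c _ => hX.real_not_seed c,
      fun u c _ => by simpa [IsTriggered, HasJoinedVia, branchLaw] using hX.real_seed c⟩
  | succ j ih =>
    have hg' : ((2 * j + 2 : ℕ) : ℕ∞) < G.egirth := lt_of_le_of_lt (by exact_mod_cast (by omega)) hg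
    obtain ⟨hv, ha⟩ := ih hg'
    have hready : ∀ u c, G.Adj u c → P.real {ω | IsReady G (X ω) j c u} =
        (branchLaw r p ε j).2 * meanOffspring r p (branchLaw r p ε j).1 := by
      intro u c h
      have hr1 : 1 ≤ r := hr u ▸ (G.degree_pos_iff_exists_adj u).2 ⟨c, h⟩
      rw [hX.real_isReady hg' hv ha, card_children_of_adj hr h.symm, Nat.cast_sub hr1, Nat.sub_sub,
        meanOffspring]
      push_cast
      ring
    refine ⟨fun u c h => ?_, fun u c h => ?_⟩
    · rw [hX.real_not_hasJoinedVia_succ, hv u c h, hready u c h]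
      rfl
    · rw [hX.real_isTriggered_succ, ha u c h, hready u c h]
      simp only [branchLaw]
      ring

end IsMarking

end BranchLaw

section ForestBound

variable {V : Type*} [Countable V] {G : SimpleGraph V} [G.LocallyFinite] {Ω : Type*}
  [MeasurableSpace Ω] {X : Ω → ℕ → V → Prop} {p ε : ℝ} {P : Measure Ω}

namespace IsMarking

variable (hX : IsMarking X p ε P)

include hX

lemma real_isIsolatedBirth_zero (v : V) :
    P.real {ω | IsIsolatedBirth G (X ω) 0 v} = p * (1 - p) ^ #(children G v v) := by
  have hset : {ω | IsIsolatedBirth G (X ω) 0 v} =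
      {ω | X ω 0 v ∧ ∀ c ∈ children G v v, ¬ X ω 0 c} := by
    ext ω
    simp only [IsIsolatedBirth, isBornAt_zero_iff, mem_ofPred_eq, mem_children]
    exact and_congr_right fun _ => forall_congr' fun c =>
      ⟨fun h hc => h hc.1, fun h hc => h ⟨hc, hc.ne'⟩⟩
  have hnot : ∀ {S : Set (ℕ × V)} {c : V}, (0, c) ∈ S →
      Measurable[marksAlgebra X S] fun ω => ¬ X ω 0 c :=
    fun hc => @Measurable.not _ (marksAlgebra X _) _ (measurable_marksAlgebra hc)
  have hforall : P.real {ω | ∀ c ∈ children G v v, ¬ X ω 0 c} = (1 - p) ^ #(children G v v) := by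
    rw [hX.real_forall (S := fun c => {(0, c)}) (fun c _ d _ hcd => by simpa using hcd)
      fun c _ => hnot (mem_singleton _), Finset.prod_congr rfl fun c _ => hX.real_not_seed c,
      Finset.prod_const]
  rw [hset, ← hforall, ← hX.real_seed v]
  refine hX.real_and (S := {(0, v)}) (T := {i | i.2 ≠ v}) (by simp)
    (measurable_marksAlgebra (mem_singleton _)) ?_
  exact @Measurable.forall _ _ (marksAlgebra X _) _ _ fun c =>
    measurable_imp_of_imp fun hc => hnot (mem_children.1 hc).2

lemma le_real_isIsolatedBirth_succ (j : ℕ) (v : V) :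
    ε * P.real {ω | IsReady G (X ω) j v v} - #(children G v v) * (ε * ε) ≤
      P.real {ω | IsIsolatedBirth G (X ω) (j + 1) v} := by
  have := hX.isProbabilityMeasure
  let B : V → Set Ω := fun c => {ω | X ω (j + 1) v ∧ X ω (j + 1) c}
  have hB : ∀ c ∈ children G v v, P.real (B c) = ε * ε := fun c hc => by
    have := hX.real_and (S := {(j + 1, v)}) (T := {(j + 1, c)})
      (by simpa using (mem_children.1 hc).2.symm) (measurable_marksAlgebra (mem_singleton _))
      (measurable_marksAlgebra (mem_singleton _))
    rwa [hX.real_mark, hX.real_mark] at this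
  have hsub : {ω | X ω (j + 1) v ∧ IsReady G (X ω) j v v} ⊆
      {ω | IsIsolatedBirth G (X ω) (j + 1) v} ∪ ⋃ c ∈ children G v v, B c := by
    intro ω hω
    by_cases h : ∃ c, G.Adj v c ∧ X ω (j + 1) c
    · obtain ⟨c, hc, hXc⟩ := h
      exact Or.inr (mem_biUnion (mem_children.2 ⟨hc, hc.ne'⟩) ⟨hω.1, hXc⟩)
    · exact Or.inl ⟨isBornAt_succ_iff.2 hω, fun c hc hborn =>
        h ⟨c, hc, (isBornAt_succ_iff.1 hborn).1⟩⟩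
  calc ε * P.real {ω | IsReady G (X ω) j v v} - #(children G v v) * (ε * ε)
      = P.real {ω | X ω (j + 1) v ∧ IsReady G (X ω) j v v} -
          ∑ c ∈ children G v v, P.real (B c) := by
        rw [hX.real_mark_and_isReady, Finset.sum_congr rfl hB, Finset.sum_const, nsmul_eq_mul]
    _ ≤ P.real {ω | X ω (j + 1) v ∧ IsReady G (X ω) j v v} -
          P.real (⋃ c ∈ children G v v, B c) := by
        gcongr
        exact measureReal_biUnion_finset_le _ _
    _ ≤ P.real {ω | IsIsolatedBirth G (X ω) (j + 1) v} :=
        sub_le_iff_le_add.2 ((measureReal_mono hsub).trans (measureReal_union_le _ _))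

variable {N : ℕ} {v : ℝ}
  (hv : ∀ u c, G.Adj u c → P.real {ω | ¬ HasJoinedVia G (X ω) N c u} = v)

include hv

lemma real_isUntouched (hg : ((2 * N + 2 : ℕ) : ℕ∞) < G.egirth) (u : V) :
    P.real {ω | IsUntouched G (X ω) N u} = (1 - p) * v ^ #(children G u u) := by
  have hadj : ∀ c ∈ children G u u, G.Adj u c := fun c hc => (mem_children.1 hc).1
  have hset : {ω | IsUntouched G (X ω) N u} =
      {ω | ¬ X ω 0 u ∧ ∀ c ∈ children G u u, ¬ HasJoinedVia G (X ω) N c u} := by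
    ext ω
    simp only [isUntouched_iff, mem_ofPred_eq, mem_children]
    exact and_congr_right fun _ => forall_congr' fun c =>
      ⟨fun h hc => h hc.1, fun h hc => h ⟨hc, hc.ne'⟩⟩
  rw [hset, hX.real_not_seed_and_forall hg hadj u, Finset.prod_congr rfl fun c hc =>
    hv u c (hadj c hc), Finset.prod_const]
  exact fun c _ => @Measurable.not _ (marksAlgebra X _) _ <| measurable_hasJoinedVia
    fun i _ x hx => measurable_marksAlgebra (Or.inl hx)

lemma real_hasWhiteWalk_succ_le {K : ℕ} (hg : ((2 * (N + K) + 2 : ℕ) : ℕ∞) < G.egirth) {a : ℝ}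
    (hv0 : 0 ≤ v) (hp : 0 ≤ 1 - p)
    (ha : ∀ u c, G.Adj u c → P.real {ω | HasWhiteWalk G (X ω) N K c u} ≤ a) (u w : V) :
    P.real {ω | HasWhiteWalk G (X ω) N (K + 1) u w} ≤
      #(children G u w) * ((1 - p) * (a * v ^ (#(children G u w) - 1))) := by
  have := hX.isProbabilityMeasure
  have hadj : ∀ c ∈ children G u w, G.Adj u c := fun c hc => (mem_children.1 hc).1
  let B : V → Set Ω := fun c => {ω | ¬ X ω 0 u ∧ HasWhiteWalk G (X ω) N K c u ∧
    ∀ c' ∈ children G u w, c' ≠ c → ¬ HasJoinedVia G (X ω) N c' u}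
  have hset : {ω | HasWhiteWalk G (X ω) N (K + 1) u w} = ⋃ c ∈ children G u w, B c := by
    ext ω
    simp only [HasWhiteWalk, mem_ofPred_eq, ← mem_children, mem_iUnion, exists_prop, B]
  rw [hset, ← nsmul_eq_mul]
  refine (measureReal_biUnion_finset_le _ _).trans (Finset.sum_le_card_nsmul _ _ _ fun c hc => ?_)
  rw [hX.real_sole_branch (Nat.le_add_right N K) hg hv hadj hc
    (measurable_hasWhiteWalk fun i x hx => measurable_marksAlgebra (Or.inl hx))]
  gcongr
  exact ha u c (hadj c hc)

lemma real_hasWhiteWalk_le_pow {r : ℕ} (hr : G.IsRegularOfDegree r) {K : ℕ}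
    (hg : ((2 * (N + K) + 2 : ℕ) : ℕ∞) < G.egirth) (hv0 : 0 ≤ v) (hp : 0 ≤ 1 - p) {u w : V}
    (huw : G.Adj u w) :
    P.real {ω | HasWhiteWalk G (X ω) N K u w} ≤ meanOffspring r p v ^ K := by
  have := hX.isProbabilityMeasure
  induction K generalizing u w with
  | zero => simp [HasWhiteWalk]
  | succ K ih =>
    have hr1 : 1 ≤ r := hr u ▸ (G.degree_pos_iff_exists_adj u).2 ⟨w, huw⟩
    have hg' : ((2 * (N + K) + 2 : ℕ) : ℕ∞) < G.egirth :=
      lt_of_le_of_lt (by exact_mod_cast (by omega)) hg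
    have h := hX.real_hasWhiteWalk_succ_le hv hg' hv0 hp (fun u c hc => ih hg' hc.symm) u w
    rw [card_children_of_adj hr huw, Nat.cast_sub hr1, Nat.sub_sub, Nat.cast_one] at h
    exact h.trans_eq (by rw [meanOffspring]; ring)

end IsMarking

/-- The lower bound for the expected share of `forestSet G X N (K + 1)` in an `r`-regular graph of
large girth: the vertices that join without a neighbour in the same round, and the untouched ones
without a white walk. -/
noncomputable def forestShare (r : ℕ) (p ε : ℝ) (N K : ℕ) : ℝ :=
  p * (1 - p) ^ r +
    ∑ j ∈ Finset.range N, (ε * (r * ((1 - p) * ((branchLaw r p ε j).2 *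
      (branchLaw r p ε j).1 ^ (r - 1)))) - r * (ε * ε)) +
    ((1 - p) * (branchLaw r p ε N).1 ^ r - r * ((1 - p) *
      (meanOffspring r p (branchLaw r p ε N).1 ^ K * (branchLaw r p ε N).1 ^ (r - 1))))

lemma IsMarking.le_sum_real_isIsolatedBirth {r N : ℕ} (hX : IsMarking X p ε P)
    (hr : G.IsRegularOfDegree r) (hg : ((2 * N + 2 : ℕ) : ℕ∞) < G.egirth) (v : V) :
    p * (1 - p) ^ r + ∑ j ∈ Finset.range N, (ε * (r * ((1 - p) * ((branchLaw r p ε j).2 *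
      (branchLaw r p ε j).1 ^ (r - 1)))) - r * (ε * ε)) ≤
        ∑ j ∈ Finset.range (N + 1), P.real {ω | IsIsolatedBirth G (X ω) j v} := by
  have hcard : #(children G v v) = r := card_children_self hr v
  rw [Finset.sum_range_succ', hX.real_isIsolatedBirth_zero, hcard, add_comm]
  gcongr with j hj
  have hgj : ((2 * j + 2 : ℕ) : ℕ∞) < G.egirth :=
    lt_of_le_of_lt (by exact_mod_cast by have := Finset.mem_range.1 hj; omega) hg
  have hlaw := hX.real_branchLaw hr hgj
  have h := hX.le_real_isIsolatedBirth_succ (G := G) j v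
  rwa [hX.real_isReady hgj hlaw.1 hlaw.2, hcard] at h

lemma IsMarking.forestShare_le_real {r N K : ℕ} (hX : IsMarking X p ε P)
    (hr : G.IsRegularOfDegree r) (hg : ((2 * (N + K) + 2 : ℕ) : ℕ∞) < G.egirth) (hp : 0 ≤ 1 - p)
    (hv0 : 0 ≤ (branchLaw r p ε N).1) (v : V) :
    forestShare r p ε N K ≤ P.real {ω | v ∈ forestSet G (X ω) N (K + 1)} := by
  have := hX.isProbabilityMeasure
  have hgN : ((2 * N + 2 : ℕ) : ℕ∞) < G.egirth := lt_of_le_of_lt (by exact_mod_cast (by omega)) hg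
  have hlaw := (hX.real_branchLaw hr hgN).1
  have hcard : #(children G v v) = r := card_children_self hr v
  let born : Set Ω := ⋃ j ∈ Finset.range (N + 1), {ω | IsIsolatedBirth G (X ω) j v}
  let untouched : Set Ω := {ω | IsUntouched G (X ω) N v}
  let white : Set Ω := {ω | HasWhiteWalk G (X ω) N (K + 1) v v}
  have hset : {ω | v ∈ forestSet G (X ω) N (K + 1)} = born ∪ untouched \ white := by
    ext ω
    simp only [forestSet, born, untouched, white, mem_ofPred_eq, mem_union, Set.mem_sdiff,
      mem_iUnion, Finset.mem_range, exists_prop]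
  have hdisj : Disjoint born (untouched \ white) := by
    refine disjoint_left.2 fun ω hborn h => ?_
    simp only [born, mem_iUnion, Finset.mem_range] at hborn
    obtain ⟨j, hj, hbirth⟩ := hborn
    exact h.1.1 (hasJoined_mono (Nat.lt_succ_iff.1 hj) hbirth.1.1)
  have hmeas : MeasurableSet (untouched \ white) :=
    ((measurable_isUntouched hX.measurable_mark N v).and
      (measurable_hasWhiteWalk fun i x _ => hX.measurable_mark i x).not).setOf
  have hborn : P.real born = ∑ j ∈ Finset.range (N + 1), P.real {ω | IsIsolatedBirth G (X ω) j v} :=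
    measureReal_biUnion_finset (fun i _ j _ hij => disjoint_left.2 fun ω hi hj =>
      hij (hi.1.eq hj.1)) fun j _ => (measurable_isIsolatedBirth hX.measurable_mark j v).setOf
  have hwhite := hX.real_hasWhiteWalk_succ_le hlaw hg hv0 hp
    (fun u c hc => hX.real_hasWhiteWalk_le_pow hlaw hr hg hv0 hp hc.symm) v v
  have huntouched := hX.real_isUntouched hlaw hgN v
  rw [hcard] at hwhite huntouched
  rw [hset, measureReal_union hdisj hmeas (measure_ne_top _ _) (measure_ne_top _ _), hborn,
    forestShare, ← huntouched]
  exact add_le_add (hX.le_sum_real_isIsolatedBirth hr hgN v)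
    ((sub_le_sub_left hwhite _).trans le_measureReal_sdiff)

end ForestBound

theorem card_mul_forestShare_le_inducedForestNumber {V : Type*} [Fintype V] {G : SimpleGraph V}
    [G.LocallyFinite] {r N K : ℕ} (hr : G.IsRegularOfDegree r)
    (hg : ((2 * (N + K) + 2 : ℕ) : ℕ∞) < G.egirth) (p ε : I)
    (hv0 : 0 ≤ (branchLaw r p ε N).1) :
    Fintype.card V * forestShare r p ε N K ≤ inducedForestNumber G := by
  obtain ⟨P, -, hX⟩ := exists_isMarking V p ε
  have := hX.isProbabilityMeasure
  obtain ⟨ω, hω⟩ := exists_sum_measureReal_le_card (μ := P)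
    fun v => (measurable_mem_forestSet (G := G) hX.measurable_mark N (K + 1) v).setOf
  have hK : ((K + 1 : ℕ) : ℕ∞) < G.egirth := lt_of_le_of_lt (by exact_mod_cast (by omega)) hg
  calc (Fintype.card V : ℝ) * forestShare r p ε N K
      = ∑ _v : V, forestShare r p ε N K := by simp
    _ ≤ _ := Finset.sum_le_sum fun v _ =>
        hX.forestShare_le_real hr hg (unitInterval.one_minus_nonneg p) hv0 v
    _ ≤ _ := hω
    _ ≤ inducedForestNumber G := by
        exact_mod_cast ncard_le_inducedForestNumber (isAcyclic_induce_forestSet hK)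

section Potential

lemma le_tangent_of_concaveOn {s : Set ℝ} {f : ℝ → ℝ} (hf : ConcaveOn ℝ s f) {x y f' : ℝ}
    (hx : x ∈ s) (hy : y ∈ s) (hd : HasDerivAt f f' x) : f y ≤ f x + f' * (y - x) := by
  rcases lt_trichotomy x y with h | rfl | h
  · have hslope := hf.slope_le_of_hasDerivAt hx hy h hd
    rw [slope_def_field, div_le_iff₀ (sub_pos.2 h)] at hslope
    linarith
  · simp
  · have hslope := hf.le_slope_of_hasDerivAt hy hx h hd
    rw [slope_def_field, le_div_iff₀ (sub_pos.2 h)] at hslope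
    linarith

variable {r : ℕ} {p v : ℝ}

lemma meanOffspring_pos (hr : 1 < r) (hp1 : p < 1) (hv : 0 < v) : 0 < meanOffspring r p v :=
  mul_pos (mul_pos (sub_pos.2 hp1) (sub_pos.2 (by exact_mod_cast hr))) (pow_pos hv _)

lemma meanOffspring_le_meanOffspring (hr : 1 ≤ r) (hp1 : p ≤ 1) {x y : ℝ} (hx : 0 ≤ x)
    (hxy : x ≤ y) : meanOffspring r p x ≤ meanOffspring r p y :=
  mul_le_mul_of_nonneg_left (pow_le_pow_left₀ hx hxy _)
    (mul_nonneg (sub_nonneg.2 hp1) (sub_nonneg.2 (by exact_mod_cast hr)))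

/-- A primitive of `v ↦ v ^ (-(r - 2))` on the positive half-line. -/
noncomputable def powPrimitive (r : ℕ) (v : ℝ) : ℝ :=
  if r = 3 then Real.log v else -(v ^ (r - 3))⁻¹ / ((r : ℝ) - 3)

/-- The first integral of the limiting dynamics: the trigger probability of a branch as a function
of its survival probability `v`. -/
noncomputable def potential (r : ℕ) (p v : ℝ) : ℝ :=
  p + (powPrimitive r v - powPrimitive r (1 - p)) / ((1 - p) * ((r : ℝ) - 1)) - (v - (1 - p))

lemma hasDerivAt_powPrimitive (hr : 3 ≤ r) (hv : 0 < v) :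
    HasDerivAt (powPrimitive r) ((v ^ (r - 2))⁻¹) v := by
  unfold powPrimitive
  rcases hr.eq_or_lt with rfl | hr
  · simpa using Real.hasDerivAt_log hv.ne'
  · simp only [if_neg hr.ne']
    obtain ⟨k, rfl⟩ : ∃ k, r = k + 4 := ⟨r - 4, by omega⟩
    simp only [show k + 4 - 3 = k + 1 by omega, show k + 4 - 2 = k + 2 by omega,
      show ((k + 4 : ℕ) : ℝ) - 3 = k + 1 by push_cast; ring]
    refine (((hasDerivAt_pow (k + 1) v).inv (by positivity)).neg.div_const _).congr_deriv ?_
    rw [Nat.add_sub_cancel]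
    push_cast
    field_simp
    ring

lemma hasDerivAt_potential (hr : 3 ≤ r) (hv : 0 < v) :
    HasDerivAt (potential r p) ((meanOffspring r p v)⁻¹ - 1) v := by
  refine ((((hasDerivAt_powPrimitive hr hv).sub_const _).div_const _).const_add p).sub
    ((hasDerivAt_id v).sub_const _) |>.congr_deriv ?_
  rw [meanOffspring, mul_inv_rev, div_eq_mul_inv]

lemma continuousOn_potential (hr : 3 ≤ r) : ContinuousOn (potential r p) (Ioi 0) :=
  fun _ hv => (hasDerivAt_potential hr hv).continuousAt.continuousWithinAt

lemma concaveOn_potential (hr : 3 ≤ r) (hp1 : p < 1) : ConcaveOn ℝ (Ioi 0) (potential r p) := by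
  refine AntitoneOn.concaveOn_of_deriv (convex_Ioi 0) (continuousOn_potential hr) ?_ ?_ <;>
    rw [interior_Ioi]
  · exact fun v hv => (hasDerivAt_potential hr hv).differentiableAt.differentiableWithinAt
  · intro x hx y hy hxy
    rw [(hasDerivAt_potential hr hx).deriv, (hasDerivAt_potential hr hy).deriv]
    exact sub_le_sub_right (inv_anti₀ (meanOffspring_pos (by omega) hp1 hx)
      (meanOffspring_le_meanOffspring (by omega) hp1.le (le_of_lt hx) hxy)) 1

lemma potential_le_tangent (hr : 3 ≤ r) (hp1 : p < 1) {x y : ℝ} (hx : 0 < x) (hy : 0 < y) :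
    potential r p y ≤ potential r p x + ((meanOffspring r p x)⁻¹ - 1) * (y - x) :=
  le_tangent_of_concaveOn (concaveOn_potential hr hp1) hx hy (hasDerivAt_potential hr hx)

lemma potential_init : potential r p (1 - p) = p := by simp [potential]

lemma tendsto_powPrimitive_nhdsGT_zero (hr : 3 ≤ r) :
    Tendsto (powPrimitive r) (𝓝[>] 0) atBot := by
  unfold powPrimitive
  rcases hr.eq_or_lt with rfl | hr
  · simpa using Real.tendsto_log_nhdsGT_zero
  · simp only [if_neg hr.ne']
    have hpow : Tendsto (fun v : ℝ => v ^ (r - 3)) (𝓝[>] 0) (𝓝[>] 0) :=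
      tendsto_nhdsWithin_iff.2
        ⟨((continuous_pow (r - 3)).tendsto' 0 0 (zero_pow (by omega))).mono_left nhdsWithin_le_nhds,
          eventually_mem_nhdsWithin.mono fun v hv => pow_pos (mem_Ioi.1 hv) _⟩
    exact (tendsto_neg_atTop_atBot.comp (tendsto_inv_nhdsGT_zero.comp hpow)).atBot_div_const
      (sub_pos.2 (by exact_mod_cast hr))

lemma tendsto_potential_nhdsGT_zero (hr : 3 ≤ r) (hp1 : p < 1) :
    Tendsto (potential r p) (𝓝[>] 0) atBot := by
  have hr1 : (1 : ℝ) < r := by exact_mod_cast (by omega : 1 < r)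
  have hlin : Tendsto (fun v : ℝ => -(v - (1 - p))) (𝓝[>] 0) (𝓝 (-(0 - (1 - p)))) :=
    ((continuous_id.sub continuous_const).neg.tendsto 0).mono_left nhdsWithin_le_nhds
  exact (tendsto_atBot_add_const_left _ p
    ((tendsto_atBot_add_const_right _ (-powPrimitive r (1 - p))
      (tendsto_powPrimitive_nhdsGT_zero hr)).atBot_div_const
        (mul_pos (sub_pos.2 hp1) (sub_pos.2 hr1)))).atBot_add hlin

/-- `z` is the zero of the potential below the initial value `1 - p`. It is the limit of the
survival probability of a branch. -/
structure IsPotentialRoot (r : ℕ) (p z : ℝ) : Prop where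
  pos : 0 < z
  lt_init : z < 1 - p
  potential_eq_zero : potential r p z = 0

lemma exists_isPotentialRoot_mem_Ioo (hr : 3 ≤ r) {lo hi : ℝ} (hlo : 0 < lo) (hlohi : lo ≤ hi)
    (hhi : hi ≤ 1 - p) (hneg : potential r p lo < 0) (hpos : 0 < potential r p hi) :
    ∃ z ∈ Ioo lo hi, IsPotentialRoot r p z := by
  obtain ⟨z, hz, hroot⟩ := intermediate_value_Ioo hlohi
    ((continuousOn_potential (p := p) hr).mono fun x hx => hlo.trans_le hx.1) ⟨hneg, hpos⟩
  exact ⟨z, hz, hlo.trans hz.1, hz.2.trans_le hhi, hroot⟩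

lemma exists_isPotentialRoot (hr : 3 ≤ r) (hp0 : 0 < p) (hp1 : p < 1) :
    ∃ z, IsPotentialRoot r p z := by
  obtain ⟨lo, hneg, hlo0, hlo1⟩ :=
    (((tendsto_potential_nhdsGT_zero hr hp1).eventually_lt_atBot 0).and
      (Ioo_mem_nhdsGT (sub_pos.2 hp1))).exists
  obtain ⟨z, -, hz⟩ := exists_isPotentialRoot_mem_Ioo hr hlo0 hlo1.le le_rfl hneg
    (potential_init.symm ▸ hp0)
  exact ⟨z, hz⟩

namespace IsPotentialRoot

variable {z : ℝ} (hz : IsPotentialRoot r p z)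

include hz

lemma lt_one : p < 1 := sub_pos.1 (hz.pos.trans hz.lt_init)

lemma meanOffspring_lt_one (hr : 3 ≤ r) (hp0 : 0 < p) : meanOffspring r p z < 1 := by
  have hp1 := hz.lt_one
  have htangent := potential_le_tangent hr hp1 hz.pos (sub_pos.2 hp1)
  rw [potential_init, hz.potential_eq_zero, zero_add] at htangent
  have hslope : 0 < (meanOffspring r p z)⁻¹ - 1 :=
    pos_of_mul_pos_left (hp0.trans_le htangent) (sub_nonneg.2 hz.lt_init.le)
  exact (one_lt_inv₀ (meanOffspring_pos (by omega) hp1 hz.pos)).1 (sub_pos.1 hslope)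

lemma potential_pos (hr : 3 ≤ r) (hp0 : 0 < p) {y : ℝ} (hzy : z < y) (hy : y ≤ 1 - p) :
    0 < potential r p y := by
  have hp1 := hz.lt_one
  have hy0 := hz.pos.trans hzy
  by_contra! hneg
  have hleft := potential_le_tangent hr hp1 hy0 hz.pos
  have hright := potential_le_tangent hr hp1 hy0 (sub_pos.2 hp1)
  rw [hz.potential_eq_zero] at hleft
  rw [potential_init] at hright
  rcases le_or_gt ((meanOffspring r p y)⁻¹ - 1) 0 with hslope | hslope
  · linarith [mul_nonpos_of_nonpos_of_nonneg hslope (sub_nonneg.2 hy)]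
  · linarith [mul_pos hslope (sub_pos.2 hzy)]

lemma potential_neg (hr : 3 ≤ r) (hp0 : 0 < p) {y : ℝ} (hy : 0 < y) (hyz : y < z) :
    potential r p y < 0 := by
  have htangent := potential_le_tangent hr hz.lt_one hz.pos hy
  have hslope := (one_lt_inv₀ (meanOffspring_pos (by omega) hz.lt_one hz.pos)).2
    (hz.meanOffspring_lt_one hr hp0)
  rw [hz.potential_eq_zero] at htangent
  nlinarith

end IsPotentialRoot

/-- The density of the induced forest when the survival probability of a branch ends at `z`: the
seeds, the vertices that join during the process, and the untouched vertices. It is `ξ(r, p)` at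
the root `z` of the potential. -/
noncomputable def forestValue (r : ℕ) (p z : ℝ) : ℝ :=
  p * (1 - p) ^ r + r / (2 * ((r : ℝ) - 1)) * ((1 - p) ^ 2 - z ^ 2) + (1 - p) * z ^ r

lemma pow_sub_pow_le_mul_sq_sub_sq {x y : ℝ} (hx : 0 ≤ x) (hxy : x ≤ y) (k : ℕ) :
    y ^ (k + 2) - x ^ (k + 2) ≤ ((k : ℝ) + 2) / 2 * y ^ k * (y ^ 2 - x ^ 2) := by
  induction k with
  | zero => simp
  | succ k ih =>
    have hy : 0 ≤ y := hx.trans hxy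
    have hpow : x ^ (k + 1) * x * (y - x) ≤ y ^ (k + 1) * ((y + x) / 2) * (y - x) := by
      have : 0 ≤ y - x := by linarith
      gcongr
      linarith
    calc y ^ (k + 1 + 2) - x ^ (k + 1 + 2)
        = y * (y ^ (k + 2) - x ^ (k + 2)) + x ^ (k + 1) * x * (y - x) := by ring
      _ ≤ y * (((k : ℝ) + 2) / 2 * y ^ k * (y ^ 2 - x ^ 2)) +
          y ^ (k + 1) * ((y + x) / 2) * (y - x) := by gcongr
      _ = (((k + 1 : ℕ) : ℝ) + 2) / 2 * y ^ (k + 1) * (y ^ 2 - x ^ 2) := by push_cast; ring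

lemma forestValue_anti_of_meanOffspring_le_one (hr : 2 ≤ r) (hp1 : p ≤ 1) {x y : ℝ} (hx : 0 ≤ x)
    (hxy : x ≤ y) (hy : meanOffspring r p y ≤ 1) : forestValue r p y ≤ forestValue r p x := by
  have hr1 : (0 : ℝ) < r - 1 := sub_pos.2 (by exact_mod_cast hr)
  obtain ⟨k, rfl⟩ : ∃ k, r = k + 2 := ⟨r - 2, by omega⟩
  have hsq : 0 ≤ y ^ 2 - x ^ 2 := sub_nonneg.2 (pow_le_pow_left₀ hx hxy 2)
  have : 0 ≤ 1 - p := sub_nonneg.2 hp1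
  have hbound : (1 - p) * (y ^ (k + 2) - x ^ (k + 2)) ≤
      (k + 2 : ℕ) / (2 * (((k + 2 : ℕ) : ℝ) - 1)) * (y ^ 2 - x ^ 2) := by
    calc (1 - p) * (y ^ (k + 2) - x ^ (k + 2))
        ≤ (1 - p) * (((k : ℝ) + 2) / 2 * y ^ k * (y ^ 2 - x ^ 2)) := by
          gcongr
          exact pow_sub_pow_le_mul_sq_sub_sq hx hxy k
      _ = (k + 2 : ℕ) / (2 * (((k + 2 : ℕ) : ℝ) - 1)) * (y ^ 2 - x ^ 2) *
          meanOffspring (k + 2) p y := by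
          rw [meanOffspring, Nat.add_sub_cancel]
          field_simp
          push_cast
          ring
      _ ≤ _ := mul_le_of_le_one_right (by positivity) hy
  unfold forestValue
  linarith

lemma forestValue_sub_le (hr : 2 ≤ r) (hp1 : p ≤ 1) {x z η : ℝ} (hx0 : 0 ≤ x)
    (hx1 : x ≤ 1) (hz0 : 0 ≤ z) (hz1 : z ≤ 1) (hη : 0 ≤ η) (hxη : x ≤ z + η)
    (hz : meanOffspring r p z ≤ 1) : forestValue r p z - 2 * η ≤ forestValue r p x := by
  rcases le_total x z with hxz | hzx
  · linarith [forestValue_anti_of_meanOffspring_le_one hr hp1 hx0 hxz hz]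
  · have hr2 : (2 : ℝ) ≤ r := by exact_mod_cast hr
    have hsq : 0 ≤ x ^ 2 - z ^ 2 := by nlinarith
    have hcoeff : (r : ℝ) / (2 * ((r : ℝ) - 1)) ≤ 1 := by
      rw [div_le_one (by linarith)]
      linarith
    have hquad : (r : ℝ) / (2 * ((r : ℝ) - 1)) * (x ^ 2 - z ^ 2) ≤ 2 * η :=
      (mul_le_of_le_one_left hsq hcoeff).trans (by nlinarith)
    have hpow : (1 - p) * z ^ r ≤ (1 - p) * x ^ r :=
      mul_le_mul_of_nonneg_left (pow_le_pow_left₀ hz0 hzx r) (sub_nonneg.2 hp1)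
    unfold forestValue
    linarith

end Potential

section BranchLawAsymptotics

variable {r : ℕ} {p ε : ℝ}

lemma branchLaw_fst_succ (j : ℕ) : (branchLaw r p ε (j + 1)).1 = (branchLaw r p ε j).1 -
    ε * ((branchLaw r p ε j).2 * meanOffspring r p (branchLaw r p ε j).1) := rfl

lemma branchLaw_snd_succ (j : ℕ) : (branchLaw r p ε (j + 1)).2 = (1 - ε) * (branchLaw r p ε j).2 +
    ε * ((branchLaw r p ε j).2 * meanOffspring r p (branchLaw r p ε j).1) := rfl

lemma meanOffspring_le_mul (hr : 3 ≤ r) (hp0 : 0 ≤ p) {v : ℝ} (hv0 : 0 ≤ v)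
    (hv1 : v ≤ 1) : meanOffspring r p v ≤ r * v := by
  have hr1 : (1 : ℝ) ≤ r := by exact_mod_cast (by omega : 1 ≤ r)
  have hpow : v ^ (r - 2) ≤ v := pow_le_of_le_one hv0 hv1 (by omega)
  calc meanOffspring r p v ≤ 1 * r * v := by
        unfold meanOffspring
        gcongr <;> linarith
    _ = r * v := by rw [one_mul]

lemma branchLaw_pos (hr : 3 ≤ r) (hp0 : 0 < p) (hp1 : p < 1) (hε0 : 0 < ε) (hε : ε * r ≤ 1 / 2)
    (j : ℕ) : 0 < (branchLaw r p ε j).1 ∧ 0 < (branchLaw r p ε j).2 ∧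
      (branchLaw r p ε j).1 + (branchLaw r p ε j).2 ≤ 1 := by
  have hr3 : (3 : ℝ) ≤ r := by exact_mod_cast hr
  induction j with
  | zero => exact ⟨sub_pos.2 hp1, hp0, (sub_add_cancel 1 p).le⟩
  | succ j ih =>
    obtain ⟨hv, ha, hva⟩ := ih
    rw [branchLaw_fst_succ, branchLaw_snd_succ]
    set v := (branchLaw r p ε j).1
    set a := (branchLaw r p ε j).2
    have hm := meanOffspring_pos (r := r) (by omega) hp1 hv
    have hε1 : ε < 1 := by nlinarith
    have hstep : ε * (a * meanOffspring r p v) < v := by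
      calc ε * (a * meanOffspring r p v) ≤ ε * (1 * (r * v)) := by
            gcongr
            · linarith
            · exact meanOffspring_le_mul hr hp0.le hv.le (by linarith)
        _ = ε * r * v := by ring
        _ < v := by nlinarith
    refine ⟨sub_pos.2 hstep, ?_, ?_⟩
    · have := mul_pos (sub_pos.2 hε1) ha
      positivity
    · linarith [mul_pos hε0 ha]

lemma antitone_branchLaw_fst (hr : 3 ≤ r) (hp0 : 0 < p) (hp1 : p < 1) (hε0 : 0 < ε)
    (hε : ε * r ≤ 1 / 2) : Antitone fun j => (branchLaw r p ε j).1 :=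
  antitone_nat_of_succ_le fun j => by
    obtain ⟨hv, ha, -⟩ := branchLaw_pos hr hp0 hp1 hε0 hε j
    exact sub_le_self _
      (mul_pos hε0 (mul_pos ha (meanOffspring_pos (by omega) hp1 hv))).le

lemma branchLaw_fst_le_init (hr : 3 ≤ r) (hp0 : 0 < p) (hp1 : p < 1) (hε0 : 0 < ε)
    (hε : ε * r ≤ 1 / 2) (j : ℕ) : (branchLaw r p ε j).1 ≤ 1 - p :=
  antitone_branchLaw_fst hr hp0 hp1 hε0 hε j.zero_le

-- Each round moves `(v, a)` along the tangent of the graph of the potential, which is concave.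
lemma potential_le_branchLaw_snd (hr : 3 ≤ r) (hp0 : 0 < p) (hp1 : p < 1) (hε0 : 0 < ε)
    (hε : ε * r ≤ 1 / 2) (j : ℕ) :
    potential r p (branchLaw r p ε j).1 ≤ (branchLaw r p ε j).2 := by
  induction j with
  | zero => exact potential_init.le
  | succ j ih =>
    have hv := (branchLaw_pos hr hp0 hp1 hε0 hε j).1
    have hv' := (branchLaw_pos hr hp0 hp1 hε0 hε (j + 1)).1
    refine (potential_le_tangent hr hp1 hv hv').trans ?_
    rw [branchLaw_fst_succ, branchLaw_snd_succ]
    have := (meanOffspring_pos (r := r) (by omega) hp1 hv).ne'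
    set v := (branchLaw r p ε j).1
    set a := (branchLaw r p ε j).2
    have htangent : ((meanOffspring r p v)⁻¹ - 1) * (v - ε * (a * meanOffspring r p v) - v) =
        (1 - ε) * a + ε * (a * meanOffspring r p v) - a := by
      field_simp
      ring
    linarith

-- The sum telescopes because `v * (v - v') ≥ (v ^ 2 - v' ^ 2) / 2`.
lemma sq_sub_sq_branchLaw_le_sum (hr : 2 ≤ r) (N : ℕ) :
    r / (2 * ((r : ℝ) - 1)) * ((1 - p) ^ 2 - (branchLaw r p ε N).1 ^ 2) ≤
      ∑ j ∈ Finset.range N, ε * (r * ((1 - p) * ((branchLaw r p ε j).2 *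
        (branchLaw r p ε j).1 ^ (r - 1)))) := by
  have hr1 : (0 : ℝ) < r - 1 := sub_pos.2 (by exact_mod_cast hr)
  induction N with
  | zero => simp [branchLaw]
  | succ N ih =>
    rw [Finset.sum_range_succ, branchLaw_fst_succ]
    set v := (branchLaw r p ε N).1
    set d := ε * ((branchLaw r p ε N).2 * meanOffspring r p v) with hd
    have hterm : ε * (r * ((1 - p) * ((branchLaw r p ε N).2 * v ^ (r - 1)))) =
        r / (2 * ((r : ℝ) - 1)) * (v ^ 2 - (v - d) ^ 2) +
          r / (2 * ((r : ℝ) - 1)) * d ^ 2 := by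
      have hpow : v ^ (r - 1) = v ^ (r - 2) * v := by
        rw [← pow_succ]
        congr 1
        omega
      calc _ = r / ((r : ℝ) - 1) * (v * d) := by
            rw [hd, hpow, meanOffspring]
            field_simp
        _ = _ := by
            field_simp
            ring
    have hsq : 0 ≤ r / (2 * ((r : ℝ) - 1)) * d ^ 2 := by positivity
    rw [hterm]
    linarith

lemma branchLaw_fst_le_of_forall_le_snd (hr : 3 ≤ r) (hp0 : 0 < p) (hp1 : p < 1) (hε0 : 0 < ε)
    (hε : ε * r ≤ 1 / 2) {x m : ℝ} (hx : 0 < x) {N : ℕ}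
    (hxN : x ≤ (branchLaw r p ε N).1) (hmN : ∀ j ≤ N, m ≤ (branchLaw r p ε j).2) :
    (branchLaw r p ε N).1 ≤ 1 - p - ε * N * (m * meanOffspring r p x) := by
  induction N with
  | zero => simp [branchLaw]
  | succ N ih =>
    have hxj := hxN.trans (antitone_branchLaw_fst hr hp0 hp1 hε0 hε N.le_succ)
    have ih := ih hxj fun j hj => hmN j (hj.trans N.le_succ)
    have hstep : ε * (m * meanOffspring r p x) ≤
        ε * ((branchLaw r p ε N).2 * meanOffspring r p (branchLaw r p ε N).1) := by
      have := (meanOffspring_pos (r := r) (by omega) hp1 hx).le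
      have := (branchLaw_pos hr hp0 hp1 hε0 hε N).2.1
      gcongr
      · exact hmN N N.le_succ
      · exact meanOffspring_le_meanOffspring (by omega) hp1.le hx.le hxj
    rw [branchLaw_fst_succ]
    push_cast
    linarith

lemma IsPotentialRoot.exists_branchLaw_le {z : ℝ} (hz : IsPotentialRoot r p z) (hr : 3 ≤ r)
    (hp0 : 0 < p) {η : ℝ} (hη : 0 < η) :
    ∃ T : ℝ, 0 < T ∧ ∀ ε : ℝ, 0 < ε → ε * r ≤ 1 / 2 → ∀ N : ℕ, T ≤ ε * N →
      (branchLaw r p ε N).1 ≤ z + η := by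
  have hp1 := hz.lt_one
  have hzη : 0 < z + η := add_pos hz.pos hη
  rcases le_or_gt (1 - p) (z + η) with hle | hlt
  · exact ⟨1, one_pos, fun ε hε0 hε N _ =>
      (branchLaw_fst_le_init hr hp0 hp1 hε0 hε N).trans hle⟩
  obtain ⟨y, hy, hmin⟩ := isCompact_Icc.exists_isMinOn (nonempty_Icc.2 hlt.le)
    ((continuousOn_potential (p := p) hr).mono fun y hy => hzη.trans_le hy.1)
  have hm : 0 < potential r p y :=
    hz.potential_pos hr hp0 ((lt_add_of_pos_right z hη).trans_le hy.1) hy.2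
  have hrate := mul_pos hm (meanOffspring_pos (r := r) (by omega) hp1 hzη)
  refine ⟨1 / (potential r p y * meanOffspring r p (z + η)), one_div_pos.2 hrate,
    fun ε hε0 hε N hN => ?_⟩
  by_contra! hN'
  have hdecrease := branchLaw_fst_le_of_forall_le_snd hr hp0 hp1 hε0 hε hzη hN'.le
    fun j hj => (hmin ⟨hN'.le.trans (antitone_branchLaw_fst hr hp0 hp1 hε0 hε hj),
      branchLaw_fst_le_init hr hp0 hp1 hε0 hε j⟩).trans
        (potential_le_branchLaw_snd hr hp0 hp1 hε0 hε j)
  rw [div_le_iff₀ hrate] at hN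
  linarith

lemma exists_step_rounds {c T δ : ℝ} (hc : 1 ≤ c) (hT : 0 < T) (hδ : 0 < δ) :
    ∃ (ε : ℝ) (N : ℕ), 0 < ε ∧ ε * c ≤ 1 / 2 ∧ T ≤ ε * N ∧ (N : ℝ) * (c * (ε * ε)) ≤ δ := by
  have : 0 < c := one_pos.trans_le hc
  obtain ⟨ε, hε0, hε, hεδ⟩ : ∃ ε : ℝ, 0 < ε ∧ ε ≤ 1 / (2 * c) ∧ ε ≤ δ / (c * (T + 1)) :=
    ⟨min (1 / (2 * c)) (δ / (c * (T + 1))), lt_min (by positivity) (by positivity),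
      min_le_left _ _, min_le_right _ _⟩
  rw [le_div_iff₀ (by positivity)] at hε hεδ
  refine ⟨ε, ⌈T / ε⌉₊, hε0, by linarith, ?_, ?_⟩
  · rw [mul_comm, ← div_le_iff₀ hε0]
    exact Nat.le_ceil _
  · have hceil : (⌈T / ε⌉₊ : ℝ) * ε ≤ T + 1 := by
      calc (⌈T / ε⌉₊ : ℝ) * ε ≤ (T / ε + 1) * ε := by
            gcongr
            exact (Nat.ceil_lt_add_one (by positivity)).le
        _ = T + ε := by field_simp
        _ ≤ T + 1 := by nlinarith
    calc (⌈T / ε⌉₊ : ℝ) * (c * (ε * ε)) = ε * (c * (⌈T / ε⌉₊ * ε)) := by ring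
      _ ≤ ε * (c * (T + 1)) := by gcongr
      _ ≤ δ := hεδ

lemma mul_meanOffspring_pow_le (hr : 1 < r) (hp0 : 0 ≤ p) (hp1 : p < 1) {v y δ : ℝ} (hv0 : 0 < v)
    (hv1 : v ≤ 1) (hvy : v ≤ y) {K : ℕ} (hK : meanOffspring r p y ^ K ≤ δ / r) :
    r * ((1 - p) * (meanOffspring r p v ^ K * v ^ (r - 1))) ≤ δ := by
  have hm := (meanOffspring_pos hr hp1 hv0).le
  have hpow : meanOffspring r p v ^ K ≤ δ / r :=
    (pow_le_pow_left₀ hm (meanOffspring_le_meanOffspring hr.le hp1.le hv0.le hvy) K).trans hK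
  have hle : (1 - p) * (meanOffspring r p v ^ K * v ^ (r - 1)) ≤ δ / r :=
    calc (1 - p) * (meanOffspring r p v ^ K * v ^ (r - 1))
        ≤ 1 * (meanOffspring r p v ^ K * 1) := by
          gcongr
          · linarith
          · exact pow_le_one₀ hv0.le hv1
      _ ≤ δ / r := by simpa using hpow
  rwa [le_div_iff₀' (by positivity)] at hle

lemma exists_meanOffspring_add_lt_one {z δ : ℝ} (hδ : 0 < δ) (hz : meanOffspring r p z < 1) :
    ∃ η : ℝ, 0 < η ∧ η ≤ δ ∧ meanOffspring r p (z + η) < 1 := by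
  have hcont : ContinuousAt (fun η : ℝ => meanOffspring r p (z + η)) 0 := by
    unfold meanOffspring
    fun_prop
  have hlt : ∀ᶠ η in 𝓝[>] (0 : ℝ), meanOffspring r p (z + η) < 1 :=
    nhdsWithin_le_nhds (hcont.eventually_lt continuousAt_const (by simpa using hz))
  obtain ⟨η, hη, hη0, hηδ⟩ := (hlt.and (Ioo_mem_nhdsGT hδ)).exists
  exact ⟨η, hη0, hηδ.le, hη⟩

lemma le_forestShare (hr : 2 ≤ r) (N K : ℕ) :
    forestValue r p (branchLaw r p ε N).1 - N * (r * (ε * ε)) -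
      r * ((1 - p) * (meanOffspring r p (branchLaw r p ε N).1 ^ K *
        (branchLaw r p ε N).1 ^ (r - 1))) ≤ forestShare r p ε N K := by
  have hsum := sq_sub_sq_branchLaw_le_sum (p := p) (ε := ε) hr N
  rw [forestShare, forestValue, Finset.sum_sub_distrib, Finset.sum_const, Finset.card_range,
    nsmul_eq_mul]
  linarith

universe u

theorem IsPotentialRoot.exists_girth_forall_le_inducedForestNumber {z : ℝ}
    (hz : IsPotentialRoot r p z) (hr : 3 ≤ r) (hp0 : 0 < p) {δ : ℝ} (hδ : 0 < δ) :
    ∃ g : ℕ, 0 < g ∧ ∀ (V : Type u) [Fintype V] (G : SimpleGraph V) [DecidableRel G.Adj],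
      G.IsRegularOfDegree r → (g : ℕ∞) ≤ G.egirth →
        (forestValue r p z - δ) * (Fintype.card V : ℝ) ≤ (inducedForestNumber G : ℝ) := by
  have hr3 : (3 : ℝ) ≤ r := by exact_mod_cast hr
  have hp1 := hz.lt_one
  have hmz := hz.meanOffspring_lt_one hr hp0
  obtain ⟨η, hη0, hηδ, hη⟩ := exists_meanOffspring_add_lt_one (show 0 < δ / 4 by positivity) hmz
  obtain ⟨K, hK⟩ := exists_pow_lt_of_lt_one (show 0 < δ / 4 / r by positivity) hη
  obtain ⟨T, hT0, hT⟩ := hz.exists_branchLaw_le hr hp0 hη0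
  obtain ⟨ε, N, hε0, hε, hN, hconflict⟩ :=
    exists_step_rounds (show (1 : ℝ) ≤ r by linarith) hT0 (show 0 < δ / 4 by positivity)
  have hv := hT ε hε0 hε N hN
  have hv0 := (branchLaw_pos hr hp0 hp1 hε0 hε N).1
  have hv1 : (branchLaw r p ε N).1 ≤ 1 :=
    (branchLaw_fst_le_init hr hp0 hp1 hε0 hε N).trans (by linarith)
  have hshare : forestValue r p z - δ ≤ forestShare r p ε N K := by
    have hz1 : z ≤ 1 := by linarith [hz.lt_init]
    linarith [le_forestShare (p := p) (ε := ε) (show 2 ≤ r by omega) N K,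
      forestValue_sub_le (by omega) hp1.le hv0.le hv1 hz.pos.le hz1 hη0.le hv hmz.le,
      mul_meanOffspring_pow_le (by omega) hp0.le hp1 hv0 hv1 hv hK.le]
  refine ⟨2 * (N + K) + 3, by omega, fun V _ G _ hreg hg => ?_⟩
  rw [mul_comm]
  exact (mul_le_mul_of_nonneg_left hshare (Nat.cast_nonneg _)).trans
    (card_mul_forestShare_le_inducedForestNumber hreg
      (lt_of_lt_of_le (by exact_mod_cast Nat.lt_succ_self _) hg) ⟨p, hp0.le, hp1.le⟩
      ⟨ε, hε0.le, by nlinarith⟩ hv0.le)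

end BranchLawAsymptotics

section ReducedEquation

lemma antitoneOn_Ici_of_hasDerivWithinAt_nonpos {f f' : ℝ → ℝ} {a : ℝ}
    (hf : ∀ x, a ≤ x → HasDerivWithinAt f (f' x) (Ici a) x) (hf' : ∀ x, a ≤ x → f' x ≤ 0) :
    AntitoneOn f (Ici a) :=
  antitoneOn_of_hasDerivWithinAt_nonpos (convex_Ici a)
    (fun x hx => (hf x hx).continuousWithinAt)
    (fun x hx => (hf x (interior_subset hx)).mono interior_subset)
    fun x hx => hf' x (interior_subset hx)

lemma eq_zero_of_hasDerivWithinAt_mul {D a : ℝ → ℝ}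
    (hD : ∀ x, 0 ≤ x → HasDerivWithinAt D (a x * D x) (Ici 0) x) (ha : ∀ x, 0 ≤ x → a x ≤ 0)
    (h0 : D 0 = 0) {x : ℝ} (hx : 0 ≤ x) : D x = 0 := by
  have hanti := antitoneOn_Ici_of_hasDerivWithinAt_nonpos (fun x hx => (hD x hx).mul (hD x hx))
    (fun x hx => by nlinarith [mul_nonneg (neg_nonneg.2 (ha x hx)) (mul_self_nonneg (D x))])
  have hle : D x * D x ≤ D 0 * D 0 := hanti (mem_Ici.2 le_rfl) hx hx
  rw [h0, mul_zero] at hle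
  exact mul_self_eq_zero.1 (hle.antisymm (mul_self_nonneg _))

/-- The speed at which the survival probability `v` of a branch decreases in the limiting
dynamics. -/
noncomputable def rate (r : ℕ) (p v : ℝ) : ℝ :=
  meanOffspring r p v * potential r p v

/-- The density `b` of births in terms of the survival probability `v` of a branch. -/
noncomputable def birthDensity (r : ℕ) (p v : ℝ) : ℝ :=
  r / ((r : ℝ) - 1) * v * rate r p v

/-- `v` solves the scalar equation `v' = -rate v` to which the system of the theorem reduces. -/
structure IsReducedSolution (r : ℕ) (p : ℝ) (v : ℝ → ℝ) : Prop where
  init : v 0 = 1 - p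
  pos : ∀ x, 0 ≤ x → 0 < v x
  rate_pos : ∀ x, 0 ≤ x → 0 < rate r p (v x)
  deriv : ∀ x, 0 ≤ x → HasDerivWithinAt v (-rate r p (v x)) (Ici 0) x

variable {r : ℕ} {p : ℝ}

lemma hasDerivAt_rate (hr : 3 ≤ r) (hp1 : p < 1) {v : ℝ} (hv : 0 < v) :
    HasDerivAt (rate r p) (((r : ℝ) - 2) * rate r p v / v + 1 - meanOffspring r p v) v := by
  have hm := (meanOffspring_pos (r := r) (by omega) hp1 hv).ne'
  have hdm : HasDerivAt (meanOffspring r p) (((r : ℝ) - 2) * meanOffspring r p v / v) v := by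
    refine ((hasDerivAt_pow (r - 2) v).const_mul ((1 - p) * ((r : ℝ) - 1))).congr_deriv ?_
    obtain ⟨k, rfl⟩ : ∃ k, r = k + 3 := ⟨r - 3, by omega⟩
    rw [meanOffspring, show k + 3 - 2 = k + 1 by omega, Nat.add_sub_cancel]
    push_cast
    field_simp
    ring
  refine (hdm.mul (hasDerivAt_potential hr hv)).congr_deriv ?_
  rw [rate]
  field_simp
  ring

lemma continuousOn_rate (hr : 3 ≤ r) (hp1 : p < 1) : ContinuousOn (rate r p) (Ioi 0) :=
  fun _ hv => (hasDerivAt_rate hr hp1 hv).continuousAt.continuousWithinAt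

lemma rate_pos_iff (hr : 1 < r) (hp1 : p < 1) {v : ℝ} (hv : 0 < v) :
    0 < rate r p v ↔ 0 < potential r p v :=
  mul_pos_iff_of_pos_left (meanOffspring_pos hr hp1 hv)

namespace IsReducedSolution

variable {v : ℝ → ℝ} {z x η : ℝ} (h : IsReducedSolution r p v)

include h

lemma antitoneOn : AntitoneOn v (Ici 0) :=
  antitoneOn_Ici_of_hasDerivWithinAt_nonpos h.deriv fun x hx =>
    neg_nonpos.2 (h.rate_pos x hx).le

lemma le_init (hx : 0 ≤ x) : v x ≤ 1 - p :=
  h.init ▸ h.antitoneOn (mem_Ici.2 le_rfl) hx hx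

lemma gt_root (hr : 3 ≤ r) (hp0 : 0 < p) (hz : IsPotentialRoot r p z) (hx : 0 ≤ x) :
    z < v x := by
  have hpos := (rate_pos_iff (by omega) hz.lt_one (h.pos x hx)).1 (h.rate_pos x hx)
  by_contra! hvz
  rcases hvz.lt_or_eq with hlt | heq
  · exact (hz.potential_neg hr hp0 (h.pos x hx) hlt).not_gt hpos
  · exact hpos.ne' (heq ▸ hz.potential_eq_zero)

lemma exists_le (hr : 3 ≤ r) (hp0 : 0 < p) (hz : IsPotentialRoot r p z) (hη : 0 < η) :
    ∃ x, 0 ≤ x ∧ v x ≤ z + η := by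
  by_contra! hgt
  have hzη : 0 < z + η := add_pos hz.pos hη
  have hle : z + η ≤ 1 - p := h.init ▸ (hgt 0 le_rfl).le
  obtain ⟨y, hy, hmin⟩ := isCompact_Icc.exists_isMinOn (nonempty_Icc.2 hle)
    ((continuousOn_rate hr hz.lt_one).mono fun y hy => hzη.trans_le hy.1)
  have hm : 0 < rate r p y :=
    (rate_pos_iff (by omega) hz.lt_one (hzη.trans_le hy.1)).2
      (hz.potential_pos hr hp0 ((lt_add_of_pos_right z hη).trans_le hy.1) hy.2)
  have hanti : AntitoneOn (fun x => v x + rate r p y * x) (Ici 0) :=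
    antitoneOn_Ici_of_hasDerivWithinAt_nonpos
      (fun x hx => (h.deriv x hx).add ((hasDerivWithinAt_id x (Ici 0)).const_mul (rate r p y)))
      fun x hx => by
        have hmin_le : rate r p y ≤ rate r p (v x) := hmin ⟨(hgt x hx).le, h.le_init hx⟩
        linarith
  have hx : 0 ≤ (1 - p) / rate r p y := div_nonneg (sub_nonneg.2 hz.lt_one.le) hm.le
  have hle_init := hanti (mem_Ici.2 le_rfl) hx hx
  simp only [h.init, mul_zero, add_zero, mul_div_cancel₀ _ hm.ne'] at hle_init
  linarith [h.pos _ hx]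

lemma tendsto (hr : 3 ≤ r) (hp0 : 0 < p) (hz : IsPotentialRoot r p z) :
    Tendsto v atTop (𝓝 z) := by
  rw [Metric.tendsto_atTop]
  intro η hη
  obtain ⟨x, hx, hvx⟩ := h.exists_le hr hp0 hz (half_pos hη)
  refine ⟨x, fun y hy => ?_⟩
  have hgt := h.gt_root hr hp0 hz (hx.trans hy)
  have hle := h.antitoneOn hx (hx.trans hy) hy
  rw [Real.dist_eq, abs_of_pos (sub_pos.2 hgt)]
  linarith

lemma integral_birthDensity (hr : 3 ≤ r) (hp0 : 0 < p) (hz : IsPotentialRoot r p z) :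
    IntegrableOn (fun x => birthDensity r p (v x)) (Ioi 0) ∧
      ∫ x in Ioi 0, birthDensity r p (v x) =
        r / (2 * ((r : ℝ) - 1)) * ((1 - p) ^ 2 - z ^ 2) := by
  have hr1 : (0 : ℝ) < r - 1 := sub_pos.2 (by exact_mod_cast (by omega : 1 < r))
  have hderiv : ∀ x, 0 ≤ x → HasDerivWithinAt (fun x => -(r / (2 * ((r : ℝ) - 1))) * v x ^ 2)
      (birthDensity r p (v x)) (Ici 0) x := fun x hx => by
    refine (((h.deriv x hx).pow 2).const_mul (-(r / (2 * ((r : ℝ) - 1))))).congr_deriv ?_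
    rw [birthDensity]
    field_simp
    ring
  have hderivAt : ∀ x ∈ Ioi (0 : ℝ), HasDerivAt (fun x => -(r / (2 * ((r : ℝ) - 1))) * v x ^ 2)
      (birthDensity r p (v x)) x := fun x hx =>
    (hderiv x (le_of_lt hx)).hasDerivAt (Ici_mem_nhds hx)
  have hnonneg : ∀ x ∈ Ioi (0 : ℝ), 0 ≤ birthDensity r p (v x) := fun x hx =>
    mul_nonneg (mul_nonneg (by positivity) (h.pos x (le_of_lt hx)).le)
      (h.rate_pos x (le_of_lt hx)).le
  have hlim := ((h.tendsto hr hp0 hz).pow 2).const_mul (-(r / (2 * ((r : ℝ) - 1))))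
  have hcont := (hderiv 0 le_rfl).continuousWithinAt
  refine ⟨integrableOn_Ioi_deriv_of_nonneg hcont hderivAt hnonneg hlim, ?_⟩
  rw [integral_Ioi_of_hasDerivAt_of_nonneg hcont hderivAt hnonneg hlim, h.init]
  ring

end IsReducedSolution

end ReducedEquation

section Reduction

/-- A solution of the system of the theorem all of whose components are positive. -/
structure IsPositiveForestSolution (r : ℕ) (p : ℝ) (w b q s t : ℝ → ℝ) : Prop
    extends IsForestODESolution r p w b q s t where
  pos_w : ∀ x, 0 ≤ x → 0 < w x
  pos_b : ∀ x, 0 ≤ x → 0 < b x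
  pos_q : ∀ x, 0 ≤ x → 0 < q x
  pos_s : ∀ x, 0 ≤ x → 0 < s x
  pos_t : ∀ x, 0 ≤ x → 0 < t x

/-- The survival probability of a branch, recovered from a solution of the system. -/
noncomputable def survival (w q : ℝ → ℝ) (x : ℝ) : ℝ := w x / √(q x)

/-- The density of branches that have just reached their root, recovered from a solution of the
system: minus the derivative of `survival`. -/
noncomputable def readiness (q s : ℝ → ℝ) (x : ℝ) : ℝ := s x / √(q x)

namespace IsPositiveForestSolution

variable {r : ℕ} {p x : ℝ} {w b q s t : ℝ → ℝ} (h : IsPositiveForestSolution r p w b q s t)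

include h

lemma t_eq (hr : 3 ≤ r) (hp1 : p < 1) (hx : 0 ≤ x) : t x = s x * s x / q x := by
  have hr1 : (0 : ℝ) < r - 1 := sub_pos.2 (by exact_mod_cast (by omega : 1 < r))
  have hr2 : (0 : ℝ) < r - 2 := sub_pos.2 (by exact_mod_cast (by omega : 2 < r))
  refine sub_eq_zero.1 (eq_zero_of_hasDerivWithinAt_mul (D := fun x => t x - s x * s x / q x)
    (a := fun x => -2 - 2 * (r : ℝ) * ((r : ℝ) - 2) * t x / (((r : ℝ) - 1) * b x)) ?_ ?_ ?_ hx)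
  · intro x hx
    have := (h.pos_w x hx).ne'
    have := (h.pos_b x hx).ne'
    have := (h.pos_q x hx).ne'
    refine ((h.deriv_t x hx).sub (((h.deriv_s x hx).mul (h.deriv_s x hx)).div
      (h.deriv_q x hx) this)).congr_deriv ?_
    simp only [Pi.mul_apply]
    field_simp
    ring
  · intro x hx
    have := h.pos_b x hx
    have := h.pos_t x hx
    have : 0 ≤ 2 * (r : ℝ) * ((r : ℝ) - 2) * t x / (((r : ℝ) - 1) * b x) := by positivity
    linarith
  · simp only [h.init_t, h.init_s, h.init_q]
    have := (sub_pos.2 hp1).ne'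
    obtain ⟨k, rfl⟩ : ∃ k, r = k + 3 := ⟨r - 3, by omega⟩
    rw [show 2 * (k + 3) - 2 = 2 * k + 4 by omega, show 2 * (k + 3) - 1 = 2 * k + 5 by omega]
    field_simp
    ring

lemma b_eq (hr : 3 ≤ r) (hp1 : p < 1) (hx : 0 ≤ x) :
    b x = r / ((r : ℝ) - 1) * (s x * w x / q x) := by
  have hr1 : (0 : ℝ) < r - 1 := sub_pos.2 (by exact_mod_cast (by omega : 1 < r))
  have hr2 : (0 : ℝ) < r - 2 := sub_pos.2 (by exact_mod_cast (by omega : 2 < r))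
  refine sub_eq_zero.1 (eq_zero_of_hasDerivWithinAt_mul
    (D := fun x => b x - r / ((r : ℝ) - 1) * (s x * w x / q x))
    (a := fun x => -1 - (r : ℝ) * ((r : ℝ) - 2) * t x / (((r : ℝ) - 1) * b x)) ?_ ?_ ?_ hx)
  · intro x hx
    have := (h.pos_w x hx).ne'
    have := (h.pos_b x hx).ne'
    have := (h.pos_q x hx).ne'
    refine ((h.deriv_b x hx).sub ((((h.deriv_s x hx).mul (h.deriv_w x hx)).div
      (h.deriv_q x hx) this).const_mul (r / ((r : ℝ) - 1)))).congr_deriv ?_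
    simp only [Pi.mul_apply]
    rw [h.t_eq hr hp1 hx]
    field_simp
    ring
  · intro x hx
    have := h.pos_b x hx
    have := h.pos_t x hx
    have : 0 ≤ (r : ℝ) * ((r : ℝ) - 2) * t x / (((r : ℝ) - 1) * b x) := by positivity
    linarith
  · simp only [h.init_b, h.init_s, h.init_q, h.init_w]
    have := (sub_pos.2 hp1).ne'
    obtain ⟨k, rfl⟩ : ∃ k, r = k + 3 := ⟨r - 3, by omega⟩
    rw [show 2 * (k + 3) - 1 = 2 * k + 5 by omega]
    field_simp
    ring

lemma sqrt_q_pos (hx : 0 ≤ x) : 0 < √(q x) := Real.sqrt_pos.2 (h.pos_q x hx)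

lemma sqrt_q_zero (hp1 : p ≤ 1) : √(q 0) = (1 - p) ^ r := by
  rw [h.init_q, mul_comm, pow_mul, Real.sqrt_sq (pow_nonneg (sub_nonneg.2 hp1) r)]

lemma hasDerivWithinAt_sqrt_q (hx : 0 ≤ x) : HasDerivWithinAt (fun x => √(q x))
    (-(((r : ℝ) - 1) * √(q x) * s x / w x)) (Ici 0) x := by
  refine ((h.deriv_q x hx).sqrt (h.pos_q x hx).ne').congr_deriv ?_
  have hsq : q x = √(q x) ^ 2 := (Real.sq_sqrt (h.pos_q x hx).le).symm
  have := (h.sqrt_q_pos hx).ne'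
  have := (h.pos_w x hx).ne'
  set y := √(q x)
  rw [hsq]
  field_simp

lemma survival_pos (hx : 0 ≤ x) : 0 < survival w q x :=
  div_pos (h.pos_w x hx) (h.sqrt_q_pos hx)

lemma readiness_pos (hx : 0 ≤ x) : 0 < readiness q s x :=
  div_pos (h.pos_s x hx) (h.sqrt_q_pos hx)

lemma survival_zero (hp1 : p < 1) : survival w q 0 = 1 - p := by
  have := sub_pos.2 hp1
  rw [survival, h.sqrt_q_zero hp1.le, h.init_w, pow_succ']
  field_simp

lemma hasDerivWithinAt_survival (hx : 0 ≤ x) :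
    HasDerivWithinAt (survival w q) (-readiness q s x) (Ici 0) x := by
  have := h.sqrt_q_pos hx
  have := (h.pos_w x hx).ne'
  refine ((h.deriv_w x hx).div (h.hasDerivWithinAt_sqrt_q hx) (h.sqrt_q_pos hx).ne').congr_deriv ?_
  rw [readiness]
  field_simp
  ring

lemma w_eq (hr : 0 < r) (hp1 : p < 1) (hx : 0 ≤ x) : w x = (1 - p) * survival w q x ^ r := by
  refine sub_eq_zero.1 (eq_zero_of_hasDerivWithinAt_mul
    (D := fun x => w x - (1 - p) * survival w q x ^ r) (a := fun x => -(r * s x / w x)) ?_ ?_ ?_ hx)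
  · intro x hx
    refine ((h.deriv_w x hx).sub
      (((h.hasDerivWithinAt_survival hx).pow r).const_mul (1 - p))).congr_deriv ?_
    have := (h.pos_w x hx).ne'
    have := (h.sqrt_q_pos hx).ne'
    have hready : readiness q s x = survival w q x * s x / w x := by
      rw [readiness, survival]
      field_simp
    rw [hready]
    obtain ⟨k, rfl⟩ : ∃ k, r = k + 1 := ⟨r - 1, by omega⟩
    rw [Nat.add_sub_cancel]
    field_simp
    ring
  · intro x hx
    have := h.pos_w x hx
    have := h.pos_s x hx
    exact neg_nonpos.2 (by positivity)
  · rw [h.survival_zero hp1, h.init_w]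
    ring

lemma q_div_w_eq (hr : 2 ≤ r) (hp1 : p < 1) (hx : 0 ≤ x) :
    q x / w x = (1 - p) * survival w q x ^ (r - 2) := by
  have := (h.survival_pos hx).ne'
  have := (h.pos_w x hx).ne'
  have := (h.sqrt_q_pos hx).ne'
  calc q x / w x = √(q x) ^ 2 / w x := by rw [Real.sq_sqrt (h.pos_q x hx).le]
    _ = w x / survival w q x ^ 2 := by
      rw [survival]
      field_simp
    _ = (1 - p) * survival w q x ^ (r - 2) := by
      nth_rw 1 [h.w_eq (by omega) hp1 hx]
      obtain ⟨k, rfl⟩ : ∃ k, r = k + 2 := ⟨r - 2, by omega⟩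
      rw [Nat.add_sub_cancel]
      field_simp
      ring

lemma meanOffspring_survival (hr : 2 ≤ r) (hp1 : p < 1) (hx : 0 ≤ x) :
    meanOffspring r p (survival w q x) = ((r : ℝ) - 1) * q x / w x := by
  rw [mul_div_assoc, h.q_div_w_eq hr hp1 hx, meanOffspring]
  ring

lemma t_eq_readiness_sq (hr : 3 ≤ r) (hp1 : p < 1) (hx : 0 ≤ x) : t x = readiness q s x ^ 2 := by
  rw [h.t_eq hr hp1 hx, readiness, div_pow, Real.sq_sqrt (h.pos_q x hx).le, pow_two]

lemma b_eq_survival_mul_readiness (hr : 3 ≤ r) (hp1 : p < 1) (hx : 0 ≤ x) :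
    b x = r / ((r : ℝ) - 1) * survival w q x * readiness q s x := by
  rw [h.b_eq hr hp1 hx, mul_assoc, survival, readiness, div_mul_div_comm (w x),
    Real.mul_self_sqrt (h.pos_q x hx).le, mul_comm (s x)]

lemma hasDerivWithinAt_readiness (hr : 3 ≤ r) (hp1 : p < 1) (hx : 0 ≤ x) :
    HasDerivWithinAt (readiness q s)
      (readiness q s x * (-1 + meanOffspring r p (survival w q x) -
        ((r : ℝ) - 2) * readiness q s x / survival w q x)) (Ici 0) x := by
  have := (h.survival_pos hx).ne'
  have := (h.readiness_pos hx).ne'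
  have := (h.pos_w x hx).ne'
  have hy := (h.sqrt_q_pos hx).ne'
  have hr1 : (0 : ℝ) < r - 1 := sub_pos.2 (by exact_mod_cast (by omega : 1 < r))
  have : (0 : ℝ) < r := by linarith
  refine ((h.deriv_s x hx).div (h.hasDerivWithinAt_sqrt_q hx) hy).congr_deriv ?_
  have hloss : (r : ℝ) * ((r : ℝ) - 2) * s x * t x / (((r : ℝ) - 1) * b x) =
      s x * (((r : ℝ) - 2) * readiness q s x / survival w q x) := by
    rw [h.t_eq_readiness_sq hr hp1 hx, h.b_eq_survival_mul_readiness hr hp1 hx]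
    field_simp
  rw [hloss, h.meanOffspring_survival (by omega) hp1 hx]
  have hs : s x = readiness q s x * √(q x) := (div_mul_cancel₀ _ hy).symm
  set Y := readiness q s x
  rw [hs]
  field_simp
  ring

lemma readiness_eq_rate (hr : 3 ≤ r) (hp1 : p < 1) (hx : 0 ≤ x) :
    readiness q s x = rate r p (survival w q x) := by
  have hr2 : (0 : ℝ) ≤ r - 2 := sub_nonneg.2 (by exact_mod_cast (by omega : 2 ≤ r))
  refine sub_eq_zero.1 (eq_zero_of_hasDerivWithinAt_mul
    (D := fun x => readiness q s x - rate r p (survival w q x))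
    (a := fun x => -(((r : ℝ) - 2) * readiness q s x / survival w q x)) ?_ ?_ ?_ hx)
  · intro x hx
    have hv := h.survival_pos hx
    refine ((h.hasDerivWithinAt_readiness hr hp1 hx).sub ((hasDerivAt_rate hr hp1
      hv).comp_hasDerivWithinAt x (h.hasDerivWithinAt_survival hx))).congr_deriv ?_
    field_simp
    ring
  · intro x hx
    have := h.survival_pos hx
    have := h.readiness_pos hx
    exact neg_nonpos.2 (by positivity)
  · have := sub_pos.2 hp1
    simp only [h.survival_zero hp1, readiness, h.sqrt_q_zero hp1.le, h.init_s, rate,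
      potential_init, meanOffspring]
    obtain ⟨k, rfl⟩ : ∃ k, r = k + 3 := ⟨r - 3, by omega⟩
    rw [show k + 3 - 2 = k + 1 by omega, show 2 * (k + 3) - 1 = 2 * k + 5 by omega]
    field_simp
    ring

lemma isReducedSolution_survival (hr : 3 ≤ r) (hp1 : p < 1) :
    IsReducedSolution r p (survival w q) where
  init := h.survival_zero hp1
  pos _ := h.survival_pos
  rate_pos _ hx := h.readiness_eq_rate hr hp1 hx ▸ h.readiness_pos hx
  deriv _ hx := h.readiness_eq_rate hr hp1 hx ▸ h.hasDerivWithinAt_survival hx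

lemma b_eq_birthDensity (hr : 3 ≤ r) (hp1 : p < 1) (hx : 0 ≤ x) :
    b x = birthDensity r p (survival w q x) := by
  rw [h.b_eq_survival_mul_readiness hr hp1 hx, h.readiness_eq_rate hr hp1 hx, birthDensity]

end IsPositiveForestSolution

end Reduction

section AutonomousEquation

/-- The time that a solution of `v' = -F v` needs to descend from `a` to `x`. -/
noncomputable def travelTime (F : ℝ → ℝ) (a x : ℝ) : ℝ := ∫ u in x..a, (F u)⁻¹

variable {F : ℝ → ℝ} {z a m x C : ℝ}

lemma travelTime_self : travelTime F a a = 0 := intervalIntegral.integral_same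

lemma hasDerivAt_travelTime (hcont : ContinuousOn F (Ioo z m)) (hpos : ∀ u ∈ Ioo z m, 0 < F u)
    (ha : a ∈ Ioo z m) (hx : x ∈ Ioo z m) : HasDerivAt (travelTime F a) (-(F x)⁻¹) x := by
  have hinv : ContinuousOn (fun u => (F u)⁻¹) (Ioo z m) := hcont.inv₀ fun u hu => (hpos u hu).ne'
  exact intervalIntegral.integral_hasDerivAt_left
    (hinv.mono (ordConnected_Ioo.uIcc_subset hx ha)).intervalIntegrable
    (hinv.stronglyMeasurableAtFilter isOpen_Ioo x hx)
    (hinv.continuousAt (isOpen_Ioo.mem_nhds hx))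

lemma continuousOn_travelTime (hcont : ContinuousOn F (Ioo z m)) (hpos : ∀ u ∈ Ioo z m, 0 < F u)
    (ha : a ∈ Ioo z m) : ContinuousOn (travelTime F a) (Ioo z m) :=
  fun _ hx => (hasDerivAt_travelTime hcont hpos ha hx).continuousAt.continuousWithinAt

lemma strictAntiOn_travelTime (hcont : ContinuousOn F (Ioo z m)) (hpos : ∀ u ∈ Ioo z m, 0 < F u)
    (ha : a ∈ Ioo z m) : StrictAntiOn (travelTime F a) (Ioo z m) :=
  strictAntiOn_of_hasDerivWithinAt_neg (convex_Ioo z m) (continuousOn_travelTime hcont hpos ha)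
    (fun _ hx => (hasDerivAt_travelTime hcont hpos ha (interior_subset hx)).hasDerivWithinAt)
    fun x hx => neg_neg_of_pos (inv_pos.2 (hpos x (interior_subset hx)))

lemma antitoneOn_travelTime_add_log (hcont : ContinuousOn F (Ioo z m))
    (hpos : ∀ u ∈ Ioo z m, 0 < F u) (hlin : ∀ u ∈ Ioo z m, F u ≤ C * (u - z))
    (ha : a ∈ Ioo z m) :
    AntitoneOn (fun x => travelTime F a x + C⁻¹ * Real.log (x - z)) (Ioo z m) := by
  have hderiv : ∀ x ∈ Ioo z m, HasDerivAt (fun x => travelTime F a x + C⁻¹ * Real.log (x - z))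
      (-(F x)⁻¹ + C⁻¹ * (1 / (x - z))) x := fun x hx =>
    (hasDerivAt_travelTime hcont hpos ha hx).add
      ((((hasDerivAt_id x).sub_const z).log (sub_pos.2 hx.1).ne').const_mul _)
  refine antitoneOn_of_hasDerivWithinAt_nonpos (convex_Ioo z m)
    (fun x hx => (hderiv x hx).continuousAt.continuousWithinAt)
    (fun x hx => (hderiv x (interior_subset hx)).hasDerivWithinAt) fun x hx => ?_
  have hx := interior_subset hx
  have hinv := inv_anti₀ (hpos x hx) (hlin x hx)
  rw [mul_inv] at hinv
  rw [one_div]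
  linarith

lemma tendsto_travelTime_nhdsGT (hC : 0 < C) (hcont : ContinuousOn F (Ioo z m))
    (hpos : ∀ u ∈ Ioo z m, 0 < F u) (hlin : ∀ u ∈ Ioo z m, F u ≤ C * (u - z))
    (ha : a ∈ Ioo z m) : Tendsto (travelTime F a) (𝓝[>] z) atTop := by
  have hsub : Tendsto (fun x => x - z) (𝓝[>] z) (𝓝[>] 0) :=
    tendsto_nhdsWithin_iff.2
      ⟨((continuous_sub_right z).tendsto' z 0 (sub_self z)).mono_left nhdsWithin_le_nhds,
        eventually_mem_nhdsWithin.mono fun _ hx => mem_Ioi.2 (sub_pos.2 hx)⟩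
  have hlog : Tendsto (fun x => C⁻¹ * Real.log (a - z) + -(C⁻¹ * Real.log (x - z)))
      (𝓝[>] z) atTop :=
    tendsto_atTop_add_const_left _ _ (tendsto_neg_atBot_atTop.comp
      ((Real.tendsto_log_nhdsGT_zero.comp hsub).const_mul_atBot (inv_pos.2 hC)))
  refine tendsto_atTop_mono' _ ?_ hlog
  filter_upwards [Ioo_mem_nhdsGT ha.1] with x hx
  have hanti := antitoneOn_travelTime_add_log hcont hpos hlin ha ⟨hx.1, hx.2.trans ha.2⟩ ha hx.2.le
  simp only [travelTime_self] at hanti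
  linarith

lemma surjOn_travelTime (hC : 0 < C) (hcont : ContinuousOn F (Ioo z m))
    (hpos : ∀ u ∈ Ioo z m, 0 < F u) (hlin : ∀ u ∈ Ioo z m, F u ≤ C * (u - z))
    (ha : a ∈ Ioo z m) (hx : x ∈ Ioo z m) :
    SurjOn (travelTime F a) (Ioo z m) (Ici (travelTime F a x)) :=
  isPreconnected_Ioo.intermediate_value_Ici hx
    (le_principal_iff.2 (Ioo_mem_nhdsGT (hx.1.trans hx.2)))
    (continuousOn_travelTime hcont hpos ha) (tendsto_travelTime_nhdsGT hC hcont hpos hlin ha)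

lemma continuousAt_of_strictAntiOn_of_rightInverse {α β : Type*} [LinearOrder α]
    [TopologicalSpace α] [OrderTopology α] [DenselyOrdered α] [LinearOrder β]
    [TopologicalSpace β] [OrderClosedTopology β] {f : α → β} {g : β → α} {a b : α} {y : β}
    (hf : StrictAntiOn f (Ioo a b)) (hg : ∀ᶠ w in 𝓝 y, g w ∈ Ioo a b ∧ f (g w) = w) :
    ContinuousAt g y := by
  obtain ⟨hmem, hfg⟩ := hg.self_of_nhds
  refine tendsto_order.2 ⟨fun l hl => ?_, fun u hu => ?_⟩
  · obtain ⟨c, hlc, hc⟩ := exists_between (max_lt hl hmem.1)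
    have hcmem : c ∈ Ioo a b := ⟨(le_max_right l a).trans_lt hlc, hc.trans hmem.2⟩
    have hlt : f (g y) < f c := hf hcmem hmem hc
    rw [hfg] at hlt
    filter_upwards [hg, Iio_mem_nhds hlt] with w hw hwc
    rw [mem_Iio, ← hw.2, hf.lt_iff_gt hw.1 hcmem] at hwc
    exact (le_max_left l a).trans_lt (hlc.trans hwc)
  · obtain ⟨c, hc, hcu⟩ := exists_between (lt_min hu hmem.2)
    have hcmem : c ∈ Ioo a b := ⟨hmem.1.trans hc, hcu.trans_le (min_le_right u b)⟩
    have hlt : f c < f (g y) := hf hmem hcmem hc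
    rw [hfg] at hlt
    filter_upwards [hg, Ioi_mem_nhds hlt] with w hw hwc
    rw [mem_Ioi, ← hw.2, hf.lt_iff_gt hcmem hw.1] at hwc
    exact hwc.trans (hcu.trans_le (min_le_left u b))

-- The solution is the inverse of the travel time, which covers `[0, ∞)` since `1 / F` is not
-- integrable at `z`.
theorem exists_hasDerivAt_autonomous (ha : a ∈ Ioo z m) (hC : 0 < C)
    (hcont : ContinuousOn F (Ioo z m)) (hpos : ∀ u ∈ Ioo z m, 0 < F u)
    (hlin : ∀ u ∈ Ioo z m, F u ≤ C * (u - z)) :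
    ∃ v : ℝ → ℝ, v 0 = a ∧ ∀ x, 0 ≤ x → v x ∈ Ioo z m ∧ HasDerivAt v (-F (v x)) x := by
  have hanti := strictAntiOn_travelTime hcont hpos ha
  obtain ⟨c, hac, hcm⟩ := exists_between ha.2
  have hc : c ∈ Ioo z m := ⟨ha.1.trans hac, hcm⟩
  have hneg : travelTime F a c < 0 := (hanti ha hc hac).trans_eq travelTime_self
  choose! v hv hτv using fun y (hy : travelTime F a c ≤ y) =>
    surjOn_travelTime hC hcont hpos hlin ha hc hy
  refine ⟨v, hanti.injOn (hv 0 hneg.le) ha ((hτv 0 hneg.le).trans travelTime_self.symm),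
    fun x hx => ?_⟩
  have hcx : travelTime F a c < x := hneg.trans_le hx
  have hinverse : ∀ᶠ y in 𝓝 x, v y ∈ Ioo z m ∧ travelTime F a (v y) = y :=
    eventually_of_mem (Ioi_mem_nhds hcx) fun y hy => ⟨hv y (le_of_lt hy), hτv y (le_of_lt hy)⟩
  have hvx := hv x hcx.le
  refine ⟨hvx, ?_⟩
  have hderiv := HasDerivAt.of_local_left_inverse
    (continuousAt_of_strictAntiOn_of_rightInverse hanti hinverse)
    (hasDerivAt_travelTime hcont hpos ha hvx)
    (neg_ne_zero.2 (inv_ne_zero (hpos _ hvx).ne')) (hinverse.mono fun y hy => hy.2)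
  rwa [inv_neg, inv_inv] at hderiv

end AutonomousEquation

section Existence

variable {r : ℕ} {p : ℝ}

lemma IsPotentialRoot.rate_le {z u m : ℝ} (hz : IsPotentialRoot r p z) (hr : 3 ≤ r)
    (hu : 0 < u) (hum : u ≤ m) (hpot : 0 ≤ potential r p u) :
    rate r p u ≤ meanOffspring r p m * ((meanOffspring r p z)⁻¹ - 1) * (u - z) := by
  have htangent := potential_le_tangent hr hz.lt_one hz.pos hu
  rw [hz.potential_eq_zero, zero_add] at htangent
  rw [rate, mul_assoc]
  exact mul_le_mul (meanOffspring_le_meanOffspring (by omega) hz.lt_one.le hu.le hum) htangent hpot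
    (meanOffspring_pos (by omega) hz.lt_one (hu.trans_le hum)).le

lemma exists_isReducedSolution (hr : 3 ≤ r) (hp0 : 0 < p) (hp1 : p < 1) :
    ∃ v, IsReducedSolution r p v := by
  obtain ⟨z, hz⟩ := exists_isPotentialRoot hr hp0 hp1
  have hp : 0 < 1 - p := sub_pos.2 hp1
  obtain ⟨m, hm, hmpos⟩ : ∃ m, 1 - p < m ∧ ∀ u ∈ Ioo (1 - p) m, 0 < potential r p u :=
    mem_nhdsGT_iff_exists_Ioo_subset.1 (nhdsWithin_le_nhds
      ((hasDerivAt_potential hr hp).continuousAt.eventually_const_lt (by rwa [potential_init])))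
  have hpot : ∀ u ∈ Ioo z m, 0 < potential r p u := fun u hu => by
    rcases le_or_gt u (1 - p) with hle | hgt
    · exact hz.potential_pos hr hp0 hu.1 hle
    · exact hmpos u ⟨hgt, hu.2⟩
  have hrate : ∀ u ∈ Ioo z m, 0 < rate r p u := fun u hu =>
    (rate_pos_iff (by omega) hp1 (hz.pos.trans hu.1)).2 (hpot u hu)
  have hslope : 0 < (meanOffspring r p z)⁻¹ - 1 :=
    sub_pos.2 ((one_lt_inv₀ (meanOffspring_pos (by omega) hp1 hz.pos)).2
      (hz.meanOffspring_lt_one hr hp0))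
  obtain ⟨v, hv0, hv⟩ := exists_hasDerivAt_autonomous (F := rate r p) ⟨hz.lt_init, hm⟩
    (mul_pos (meanOffspring_pos (by omega) hp1 (hp.trans hm)) hslope)
    ((continuousOn_rate hr hp1).mono fun u hu => hz.pos.trans hu.1) hrate
    fun u hu => hz.rate_le hr (hz.pos.trans hu.1) hu.2.le (hpot u hu).le
  exact ⟨v, hv0, fun x hx => hz.pos.trans (hv x hx).1.1, fun x hx => hrate _ (hv x hx).1,
    fun x hx => (hv x hx).2.hasDerivWithinAt⟩

namespace IsReducedSolution

variable {v : ℝ → ℝ} {x : ℝ} (h : IsReducedSolution r p v)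

include h

lemma hasDerivWithinAt_rate (hr : 3 ≤ r) (hp1 : p < 1) (hx : 0 ≤ x) :
    HasDerivWithinAt (fun x => rate r p (v x)) ((((r : ℝ) - 2) * rate r p (v x) / v x + 1 -
      meanOffspring r p (v x)) * -rate r p (v x)) (Ici 0) x :=
  (hasDerivAt_rate hr hp1 (h.pos x hx)).comp_hasDerivWithinAt x (h.deriv x hx)

lemma deriv_b (hr : 3 ≤ r) (hp1 : p < 1) (hx : 0 ≤ x) :
    HasDerivWithinAt (fun x => birthDensity r p (v x)) (-birthDensity r p (v x) -
      r * rate r p (v x) ^ 2 + r * ((1 - p) * v x ^ (r - 1) * rate r p (v x))) (Ici 0) x := by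
  have := (h.pos x hx).ne'
  refine (((h.deriv x hx).const_mul _).mul (h.hasDerivWithinAt_rate hr hp1 hx)).congr_deriv ?_
  obtain ⟨k, rfl⟩ : ∃ k, r = k + 2 := ⟨r - 2, by omega⟩
  rw [birthDensity, meanOffspring, Nat.add_sub_cancel, show k + 2 - 1 = k + 1 by omega,
    show ((k + 2 : ℕ) : ℝ) - 1 = k + 1 by push_cast; ring]
  push_cast
  field_simp
  ring

lemma deriv_q (hr : 2 ≤ r) (hp1 : p < 1) (hx : 0 ≤ x) :
    HasDerivWithinAt (fun x => (1 - p) ^ 2 * v x ^ (2 * r - 2))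
      (-((2 * (r : ℝ) - 2) * ((1 - p) ^ 2 * v x ^ (2 * r - 2)) *
        ((1 - p) * v x ^ (r - 1) * rate r p (v x)) / ((1 - p) * v x ^ r))) (Ici 0) x := by
  have := (h.pos x hx).ne'
  have := (sub_pos.2 hp1).ne'
  refine (((h.deriv x hx).pow (2 * r - 2)).const_mul ((1 - p) ^ 2)).congr_deriv ?_
  obtain ⟨k, rfl⟩ : ∃ k, r = k + 2 := ⟨r - 2, by omega⟩
  rw [show 2 * (k + 2) - 2 - 1 = 2 * k + 1 by omega, show 2 * (k + 2) - 2 = 2 * k + 2 by omega,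
    show k + 2 - 1 = k + 1 by omega]
  push_cast
  field_simp
  ring

lemma deriv_s (hr : 3 ≤ r) (hp1 : p < 1) (hx : 0 ≤ x) :
    HasDerivWithinAt (fun x => (1 - p) * v x ^ (r - 1) * rate r p (v x))
      (-((1 - p) * v x ^ (r - 1) * rate r p (v x)) +
        ((r : ℝ) - 1) * ((1 - p) ^ 2 * v x ^ (2 * r - 2)) *
          ((1 - p) * v x ^ (r - 1) * rate r p (v x)) / ((1 - p) * v x ^ r) -
        ((r : ℝ) - 1) * ((1 - p) * v x ^ (r - 1) * rate r p (v x)) ^ 2 / ((1 - p) * v x ^ r) -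
        r * ((r : ℝ) - 2) * ((1 - p) * v x ^ (r - 1) * rate r p (v x)) * rate r p (v x) ^ 2 /
          (((r : ℝ) - 1) * birthDensity r p (v x))) (Ici 0) x := by
  have := (h.pos x hx).ne'
  have := (h.rate_pos x hx).ne'
  have := (sub_pos.2 hp1).ne'
  have : (r : ℝ) - 1 ≠ 0 := (sub_pos.2 (by exact_mod_cast (by omega : 1 < r))).ne'
  refine ((((h.deriv x hx).pow (r - 1)).const_mul (1 - p)).mul
    (h.hasDerivWithinAt_rate hr hp1 hx)).congr_deriv ?_
  rw [birthDensity, meanOffspring]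
  obtain ⟨k, rfl⟩ : ∃ k, r = k + 2 := ⟨r - 2, by omega⟩
  simp only [Pi.pow_apply]
  rw [show 2 * (k + 2) - 2 = 2 * k + 2 by omega, show k + 2 - 1 = k + 1 by omega,
    Nat.add_sub_cancel, Nat.add_sub_cancel]
  push_cast at this ⊢
  field_simp
  ring

lemma deriv_t (hr : 3 ≤ r) (hp1 : p < 1) (hx : 0 ≤ x) :
    HasDerivWithinAt (fun x => rate r p (v x) ^ 2)
      (-2 * rate r p (v x) ^ 2 +
        2 * ((r : ℝ) - 1) * ((1 - p) * v x ^ (r - 1) * rate r p (v x)) ^ 2 /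
          ((1 - p) * v x ^ r) -
        2 * (r : ℝ) * ((r : ℝ) - 2) * (rate r p (v x) ^ 2) ^ 2 /
          (((r : ℝ) - 1) * birthDensity r p (v x))) (Ici 0) x := by
  have := (h.pos x hx).ne'
  have := (h.rate_pos x hx).ne'
  have := (sub_pos.2 hp1).ne'
  have : (r : ℝ) - 1 ≠ 0 := (sub_pos.2 (by exact_mod_cast (by omega : 1 < r))).ne'
  refine ((h.hasDerivWithinAt_rate hr hp1 hx).pow 2).congr_deriv ?_
  rw [birthDensity, meanOffspring]
  obtain ⟨k, rfl⟩ : ∃ k, r = k + 2 := ⟨r - 2, by omega⟩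
  rw [show k + 2 - 1 = k + 1 by omega, Nat.add_sub_cancel]
  push_cast at this ⊢
  field_simp
  ring

lemma isForestODESolution (hr : 3 ≤ r) (hp1 : p < 1) :
    IsForestODESolution r p (fun x => (1 - p) * v x ^ r) (fun x => birthDensity r p (v x))
      (fun x => (1 - p) ^ 2 * v x ^ (2 * r - 2))
      (fun x => (1 - p) * v x ^ (r - 1) * rate r p (v x)) (fun x => rate r p (v x) ^ 2) where
  deriv_w x hx := (((h.deriv x hx).pow r).const_mul (1 - p)).congr_deriv (by ring)
  deriv_b _ hx := h.deriv_b hr hp1 hx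
  deriv_q _ hx := h.deriv_q (by omega) hp1 hx
  deriv_s _ hx := h.deriv_s hr hp1 hx
  deriv_t _ hx := h.deriv_t hr hp1 hx
  init_w := by rw [h.init, pow_succ']
  init_b := by
    have : (r : ℝ) - 1 ≠ 0 := (sub_pos.2 (by exact_mod_cast (by omega : 1 < r))).ne'
    rw [birthDensity, rate, h.init, potential_init, meanOffspring]
    obtain ⟨k, rfl⟩ : ∃ k, r = k + 2 := ⟨r - 2, by omega⟩
    rw [Nat.add_sub_cancel]
    field_simp
    ring
  init_q := by rw [h.init, ← pow_add, Nat.add_sub_cancel' (by omega)]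
  init_s := by
    rw [rate, h.init, potential_init, meanOffspring]
    obtain ⟨k, rfl⟩ : ∃ k, r = k + 2 := ⟨r - 2, by omega⟩
    rw [Nat.add_sub_cancel, show k + 2 - 1 = k + 1 by omega,
      show 2 * (k + 2) - 1 = 2 * k + 3 by omega]
    ring
  init_t := by
    rw [rate, h.init, potential_init, meanOffspring]
    obtain ⟨k, rfl⟩ : ∃ k, r = k + 2 := ⟨r - 2, by omega⟩
    rw [Nat.add_sub_cancel, show 2 * (k + 2) - 2 = 2 * k + 2 by omega]
    ring

lemma isPositiveForestSolution (hr : 3 ≤ r) (hp1 : p < 1) :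
    IsPositiveForestSolution r p (fun x => (1 - p) * v x ^ r) (fun x => birthDensity r p (v x))
      (fun x => (1 - p) ^ 2 * v x ^ (2 * r - 2))
      (fun x => (1 - p) * v x ^ (r - 1) * rate r p (v x)) (fun x => rate r p (v x) ^ 2) where
  toIsForestODESolution := h.isForestODESolution hr hp1
  pos_w x hx := mul_pos (sub_pos.2 hp1) (pow_pos (h.pos x hx) r)
  pos_b x hx := mul_pos (mul_pos (div_pos (by positivity)
    (sub_pos.2 (by exact_mod_cast (by omega : 1 < r)))) (h.pos x hx)) (h.rate_pos x hx)
  pos_q x hx := mul_pos (pow_pos (sub_pos.2 hp1) 2) (pow_pos (h.pos x hx) _)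
  pos_s x hx := mul_pos (mul_pos (sub_pos.2 hp1) (pow_pos (h.pos x hx) _)) (h.rate_pos x hx)
  pos_t x hx := pow_pos (h.rate_pos x hx) 2

end IsReducedSolution

lemma exists_isPositiveForestSolution (hr : 3 ≤ r) (hp0 : 0 < p) (hp1 : p < 1) :
    ∃ w b q s t, IsPositiveForestSolution r p w b q s t := by
  obtain ⟨v, hv⟩ := exists_isReducedSolution hr hp0 hp1
  exact ⟨_, _, _, _, _, hv.isPositiveForestSolution hr hp1⟩

namespace IsPositiveForestSolution

variable {z : ℝ} {w b q s t : ℝ → ℝ} (h : IsPositiveForestSolution r p w b q s t)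

include h

lemma tendsto_survival (hr : 3 ≤ r) (hp0 : 0 < p) (hz : IsPotentialRoot r p z) :
    Tendsto (survival w q) atTop (𝓝 z) :=
  (h.isReducedSolution_survival hr hz.lt_one).tendsto hr hp0 hz

lemma tendsto_w (hr : 3 ≤ r) (hp0 : 0 < p) (hz : IsPotentialRoot r p z) :
    Tendsto w atTop (𝓝 ((1 - p) * z ^ r)) :=
  (((h.tendsto_survival hr hp0 hz).pow r).const_mul (1 - p)).congr'
    ((eventually_ge_atTop 0).mono fun _ hx => (h.w_eq (by omega) hz.lt_one hx).symm)

lemma tendsto_mul_q_div_w (hr : 3 ≤ r) (hp0 : 0 < p) (hz : IsPotentialRoot r p z) :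
    Tendsto (fun x => ((r : ℝ) - 1) * q x / w x) atTop (𝓝 (meanOffspring r p z)) :=
  (((h.tendsto_survival hr hp0 hz).pow (r - 2)).const_mul ((1 - p) * ((r : ℝ) - 1))).congr'
    ((eventually_ge_atTop 0).mono fun _ hx => h.meanOffspring_survival (by omega) hz.lt_one hx)

lemma integral_b (hr : 3 ≤ r) (hp0 : 0 < p) (hz : IsPotentialRoot r p z) :
    IntegrableOn b (Ioi 0) ∧
      ∫ x in Ioi 0, b x = r / (2 * ((r : ℝ) - 1)) * ((1 - p) ^ 2 - z ^ 2) := by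
  have hb : EqOn b (fun x => birthDensity r p (survival w q x)) (Ioi 0) :=
    fun x hx => h.b_eq_birthDensity hr hz.lt_one (le_of_lt hx)
  rw [integrableOn_congr_fun hb measurableSet_Ioi, setIntegral_congr_fun measurableSet_Ioi hb]
  exact (h.isReducedSolution_survival hr hz.lt_one).integral_birthDensity hr hp0 hz

end IsPositiveForestSolution

theorem isForestConstant_iff {z c : ℝ} (hr : 3 ≤ r) (hp0 : 0 < p) (hz : IsPotentialRoot r p z) :
    IsForestConstant r p c ↔ c = forestValue r p z := by
  have hsubcritical := hz.meanOffspring_lt_one hr hp0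
  constructor
  · rintro ⟨w, b, q, s, t, hsol, hpos, -, wInf, ℓ, hw, hℓ, rfl⟩
    have h : IsPositiveForestSolution r p w b q s t :=
      ⟨hsol, fun x hx => (hpos x hx).1, fun x hx => (hpos x hx).2.1,
        fun x hx => (hpos x hx).2.2.1, fun x hx => (hpos x hx).2.2.2.1,
        fun x hx => (hpos x hx).2.2.2.2⟩
    rw [tendsto_nhds_unique hw (h.tendsto_w hr hp0 hz),
      tendsto_nhds_unique hℓ (h.tendsto_mul_q_div_w hr hp0 hz), (h.integral_b hr hp0 hz).2,
      if_pos hsubcritical, forestValue]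
  · rintro rfl
    obtain ⟨w, b, q, s, t, h⟩ := exists_isPositiveForestSolution hr hp0 hz.lt_one
    refine ⟨w, b, q, s, t, h.toIsForestODESolution,
      fun x hx => ⟨h.pos_w x hx, h.pos_b x hx, h.pos_q x hx, h.pos_s x hx, h.pos_t x hx⟩,
      (h.integral_b hr hp0 hz).1, _, _, h.tendsto_w hr hp0 hz,
      h.tendsto_mul_q_div_w hr hp0 hz, ?_⟩
    rw [(h.integral_b hr hp0 hz).2, if_pos hsubcritical, forestValue]

end Existence

section Numerics

lemma exists_isForestConstant_of_bracket {r : ℕ} {a A : ℝ} (p lo hi : ℝ) (hr : 3 ≤ r)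
    (hp0 : 0 < p) (hp1 : p < 1) (hlo : 0 < lo) (hlohi : lo ≤ hi) (hhi : hi ≤ 1 - p)
    (hneg : potential r p lo < 0) (hpos : 0 < potential r p hi) (hm : meanOffspring r p hi ≤ 1)
    (ha : a ≤ forestValue r p hi) (hA : forestValue r p lo < A) :
    ∃ p₀ c : ℝ, 0 < p₀ ∧ p₀ < 1 ∧ IsForestConstant r p₀ c ∧ a ≤ c ∧ c < A := by
  obtain ⟨z, ⟨hloz, hzhi⟩, hz⟩ := exists_isPotentialRoot_mem_Ioo hr hlo hlohi hhi hneg hpos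
  refine ⟨p, forestValue r p z, hp0, hp1, (isForestConstant_iff hr hp0 hz).2 rfl, ha.trans ?_,
    hA.trans_le' ?_⟩
  · exact forestValue_anti_of_meanOffspring_le_one (by omega) hp1.le hz.pos.le hzhi.le hm
  · exact forestValue_anti_of_meanOffspring_le_one (by omega) hp1.le hlo.le hloz.le
      (hz.meanOffspring_lt_one hr hp0).le

lemma potential_three {p v : ℝ} (hp1 : p < 1) (hv : 0 < v) :
    potential 3 p v = p + Real.log (v / (1 - p)) / (2 * (1 - p)) - (v - (1 - p)) := by
  rw [potential, powPrimitive, powPrimitive, if_pos rfl, if_pos rfl,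
    Real.log_div hv.ne' (sub_pos.2 hp1).ne']
  norm_num [mul_comm]

lemma neg_lt_log_bracket : -(15912 / 10000) < Real.log (2035 / 10000 / (1 - 21 / 20000)) := by
  have hexp := Real.sum_le_exp_of_nonneg (show (0 : ℝ) ≤ 7956 / 10000 by norm_num) 9
  have hsq := pow_le_pow_left₀ (by positivity) hexp 2
  rw [← Real.exp_nat_mul] at hsq
  rw [Real.lt_log_iff_exp_lt (by norm_num), Real.exp_neg, inv_lt_comm₀ (Real.exp_pos _)
    (by norm_num)]
  norm_num [Finset.sum_range_succ, Nat.factorial] at hsq ⊢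
  linarith

lemma log_bracket_lt_neg : Real.log (2033 / 10000 / (1 - 21 / 20000)) < -(15919 / 10000) := by
  have hexp := Real.exp_bound' (show (0 : ℝ) ≤ 15919 / 20000 by norm_num) (by norm_num)
    (show 0 < 9 by norm_num)
  have hsq := pow_le_pow_left₀ (Real.exp_pos _).le hexp 2
  rw [← Real.exp_nat_mul] at hsq
  rw [Real.log_lt_iff_lt_exp (by norm_num), Real.exp_neg, lt_inv_comm₀ (by norm_num)
    (Real.exp_pos _)]
  norm_num [Finset.sum_range_succ, Nat.factorial] at hsq ⊢
  linarith

lemma exists_isForestConstant_three : ∃ p₀ c : ℝ, 0 < p₀ ∧ p₀ < 1 ∧ IsForestConstant 3 p₀ c ∧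
    0.7268 ≤ c ∧ c < 0.7268 + 1 / 10 ^ 4 := by
  have hneg : potential 3 (21 / 20000) (2033 / 10000) < 0 := by
    rw [potential_three (by norm_num) (by norm_num)]
    have := log_bracket_lt_neg
    norm_num at this ⊢
    linarith
  have hpos : 0 < potential 3 (21 / 20000) (2035 / 10000) := by
    rw [potential_three (by norm_num) (by norm_num)]
    have := neg_lt_log_bracket
    norm_num at this ⊢
    linarith
  refine exists_isForestConstant_of_bracket _ _ _ le_rfl ?_ ?_ ?_ ?_ ?_ hneg hpos ?_ ?_ ?_ <;>
    norm_num [forestValue, meanOffspring]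

lemma exists_isForestConstant_of_mem_forestTable {r : ℕ} {a A : ℝ}
    (h : (r, a, A) ∈ forestTable) :
    ∃ p₀ c : ℝ, 0 < p₀ ∧ p₀ < 1 ∧ IsForestConstant r p₀ c ∧ a ≤ c ∧ c < a + 1 / 10 ^ 4 := by
  simp only [forestTable, List.mem_cons, Prod.mk.injEq, List.not_mem_nil, or_false] at h
  rcases h with ⟨rfl, rfl, rfl⟩ | ⟨rfl, rfl, rfl⟩ | ⟨rfl, rfl, rfl⟩ | ⟨rfl, rfl, rfl⟩ |
    ⟨rfl, rfl, rfl⟩ | ⟨rfl, rfl, rfl⟩ | ⟨rfl, rfl, rfl⟩ | ⟨rfl, rfl, rfl⟩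
  · exact exists_isForestConstant_three
  · apply exists_isForestConstant_of_bracket 0.001 0.33347 0.33353 <;>
      norm_num [potential, powPrimitive, meanOffspring, forestValue]
  · apply exists_isForestConstant_of_bracket 0.00095 0.42164 0.42170 <;>
      norm_num [potential, powPrimitive, meanOffspring, forestValue]
  · apply exists_isForestConstant_of_bracket 0.0011 0.48614 0.48620 <;>
      norm_num [potential, powPrimitive, meanOffspring, forestValue]
  · apply exists_isForestConstant_of_bracket 0.00105 0.53577 0.53583 <;>
      norm_num [potential, powPrimitive, meanOffspring, forestValue]
  · apply exists_isForestConstant_of_bracket 0.0011 0.57541 0.57547 <;>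
      norm_num [potential, powPrimitive, meanOffspring, forestValue]
  · apply exists_isForestConstant_of_bracket 0.00075 0.60790 0.60796 <;>
      norm_num [potential, powPrimitive, meanOffspring, forestValue]
  · apply exists_isForestConstant_of_bracket 0.00105 0.63518 0.63524 <;>
      norm_num [potential, powPrimitive, meanOffspring, forestValue]

lemma three_le_of_mem_forestTable {r : ℕ} {a A : ℝ} (h : (r, a, A) ∈ forestTable) : 3 ≤ r := by
  simp only [forestTable, List.mem_cons, Prod.mk.injEq, List.not_mem_nil, or_false] at h
  omega

lemma eq_one_sub_of_mem_forestTable {r : ℕ} {a A : ℝ} (h : (r, a, A) ∈ forestTable) :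
    A = 1 - a := by
  simp only [forestTable, List.mem_cons, Prod.mk.injEq, List.not_mem_nil, or_false] at h
  rcases h with ⟨-, rfl, rfl⟩ | ⟨-, rfl, rfl⟩ | ⟨-, rfl, rfl⟩ | ⟨-, rfl, rfl⟩ |
    ⟨-, rfl, rfl⟩ | ⟨-, rfl, rfl⟩ | ⟨-, rfl, rfl⟩ | ⟨-, rfl, rfl⟩ <;> norm_num

end Numerics

lemma exists_isAcyclic_card_eq_inducedForestNumber {V : Type*} [Fintype V] (G : SimpleGraph V) :
    ∃ S : Finset V, #S = inducedForestNumber G ∧ (G.induce (S : Set V)).IsAcyclic := by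
  refine Nat.sSup_mem (s := {k : ℕ | ∃ S : Finset V, #S = k ∧ (G.induce (S : Set V)).IsAcyclic})
    ⟨0, ∅, rfl, fun v => absurd v.2 (by simp)⟩ ⟨Fintype.card V, ?_⟩
  rintro k ⟨T, rfl, -⟩
  exact T.card_le_univ

lemma decyclingNumber_add_inducedForestNumber_le {V : Type*} [Fintype V] (G : SimpleGraph V) :
    decyclingNumber G + inducedForestNumber G ≤ Fintype.card V := by
  classical
  obtain ⟨S, hS, hac⟩ := exists_isAcyclic_card_eq_inducedForestNumber G
  have hle : decyclingNumber G ≤ #Sᶜ :=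
    Nat.sInf_le ⟨Sᶜ, rfl, by rwa [Finset.coe_compl, compl_compl]⟩
  have := S.card_add_card_compl
  omega

section Conclusion

variable {r : ℕ} {p : ℝ}

lemma existsUnique_isForestConstant (hr : 3 ≤ r) (hp0 : 0 < p) (hp1 : p < 1) :
    ∃! c : ℝ, IsForestConstant r p c := by
  obtain ⟨z, hz⟩ := exists_isPotentialRoot hr hp0 hp1
  exact ⟨_, (isForestConstant_iff hr hp0 hz).2 rfl, fun _ => (isForestConstant_iff hr hp0 hz).1⟩

lemma IsForestConstant.exists_girth_forall_le_inducedForestNumber {c δ : ℝ}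
    (hc : IsForestConstant r p c) (hr : 3 ≤ r) (hp0 : 0 < p) (hp1 : p < 1) (hδ : 0 < δ) :
    ∃ g : ℕ, 0 < g ∧
      ∀ (V : Type*) [Fintype V] (G : SimpleGraph V) [DecidableRel G.Adj],
        G.IsRegularOfDegree r → (g : ℕ∞) ≤ G.egirth →
          (c - δ) * (Fintype.card V : ℝ) ≤ (inducedForestNumber G : ℝ) := by
  obtain ⟨z, hz⟩ := exists_isPotentialRoot hr hp0 hp1
  rw [(isForestConstant_iff hr hp0 hz).1 hc]
  exact hz.exists_girth_forall_le_inducedForestNumber hr hp0 hδ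

end Conclusion

theorem theorem1p1 :
    (∀ r : ℕ, 3 ≤ r → ∀ p₀ : ℝ, 0 < p₀ → p₀ < 1 →
      (∃! c : ℝ, IsForestConstant r p₀ c) ∧
      ∀ c : ℝ, IsForestConstant r p₀ c → ∀ δ : ℝ, 0 < δ →
        ∃ g : ℕ, 0 < g ∧
          ∀ (V : Type*) [Fintype V] (G : SimpleGraph V) [DecidableRel G.Adj],
            G.IsRegularOfDegree r → (g : ℕ∞) ≤ G.egirth →
              (c - δ) * (Fintype.card V : ℝ) ≤ (inducedForestNumber G : ℝ)) ∧
    (∀ (r : ℕ) (a A : ℝ), (r, a, A) ∈ forestTable →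
      A = 1 - a ∧
      (∃ p₀ c : ℝ, 0 < p₀ ∧ p₀ < 1 ∧ IsForestConstant r p₀ c ∧
        a ≤ c ∧ c < a + 1 / 10 ^ 4) ∧
      ∀ δ : ℝ, 0 < δ →
        ∃ g : ℕ, 0 < g ∧
          ∀ (V : Type*) [Fintype V] (G : SimpleGraph V) [DecidableRel G.Adj],
            G.IsRegularOfDegree r → (g : ℕ∞) ≤ G.egirth →
              (a - δ) * (Fintype.card V : ℝ) ≤ (inducedForestNumber G : ℝ) ∧
              (decyclingNumber G : ℝ) ≤ (A + δ) * (Fintype.card V : ℝ)) := by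
  refine ⟨fun r hr p hp0 hp1 => ⟨existsUnique_isForestConstant hr hp0 hp1, fun c hc δ hδ =>
    hc.exists_girth_forall_le_inducedForestNumber hr hp0 hp1 hδ⟩, fun r a A h => ?_⟩
  obtain ⟨p, c, hp0, hp1, hc, hac, hcA⟩ := exists_isForestConstant_of_mem_forestTable h
  obtain rfl := eq_one_sub_of_mem_forestTable h
  refine ⟨rfl, ⟨p, c, hp0, hp1, hc, hac, hcA⟩, fun δ hδ => ?_⟩
  obtain ⟨g, hg, hforest⟩ := hc.exists_girth_forall_le_inducedForestNumber
    (three_le_of_mem_forestTable h) hp0 hp1 hδ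
  refine ⟨g, hg, fun V _ G _ hreg hgirth => ?_⟩
  have hτ : (a - δ) * (Fintype.card V : ℝ) ≤ inducedForestNumber G :=
    (mul_le_mul_of_nonneg_right (sub_le_sub_right hac δ) (Nat.cast_nonneg _)).trans
      (hforest V G hreg hgirth)
  have hφτ : (decyclingNumber G : ℝ) + inducedForestNumber G ≤ Fintype.card V := by
    exact_mod_cast decyclingNumber_add_inducedForestNumber_le G
  exact ⟨hτ, by linarith⟩
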